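/- **Theorem.** For every failure probability $\delta\in(0,1)$ there are constants $C_0,C_1,c_2,C_2>0$, depending only on $\delta$, such that the following holds for all integers $1\le q\le d$ and all $\varepsilon\in(0,1)$ with $q\ge C_0\,\log d/\varepsilon^2$. There are integers $k\le C_1\sqrt{d/q}\,/\varepsilon^2$ and $m$ with $c_2/\varepsilon^2\le m\le C_2/\varepsilon^2$, and a two-party protocol with the following properties. * Alice starts with $k$ copies of a pure state $|\psi\rangle\in\mathbb{C}^d$ and Bob with $k$ copies of a pure state $|\phi\rangle\in\mathbb{C}^d$; the protocol does not depend on $|\psi\rangle,|\phi\rangle$. Using shared classical randomness, the parties perform local quantum operations and measurements with unlimited two-way classical communication ($\mathsf{LOCC}$, adaptively in finitely many rounds), and they exchange exactly $m$ quantum messages, each of which is a $q$-dimensional quantum system. * At the end they output a real number $X$, and for all unit vectors $|\psi\rangle,|\phi\rangle\in\mathbb{C}^d$, $$\Pr\Big[\,\big|X-|\langle\psi|\phi\rangle|^2\big|\le\varepsilon\Big]\ \ge\ 1-\delta .$$ That is, for $q=\Omega(\log d/\varepsilon^2)$, $k=O(\sqrt{d/q}/\varepsilon^2)$ copies of each state,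 $\Theta(1/\varepsilon^2)$ $q$-dimensional quantum messages and $\mathsf{LOCC}$ suffice to estimate $|\langle\psi|\phi\rangle|^2$ to error $\varepsilon$ with high probability. -/

import Mathlib

open scoped Matrix

/-- An interactive two-party protocol in which Alice holds a quantum system with (finite)
orthonormal basis `A`, Bob holds one with basis `B`, and every quantum message is a
`q`-dimensional register.  It is a finite decision tree:

* `output x` stops and announces the real number `x`;
* `alice K hK next` (resp. `bob K hK next`) is a local measurement with Kraus operators
  `K 0, …, K (n - 1)` (arbitrary local operations, including unitaries, adding ancillas,
  discarding registers and tossing local coins); its outcome `i` is announced over the free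
  classical channel, so that all that follows, on both sides, may depend on it;
* `sendToBob` (resp. `sendToAlice`) is one quantum message: a `q`-dimensional register that is
  part of the sender's system becomes part of the receiver's system.

A protocol without the last two constructors is an `LOCC` protocol. -/
inductive Protocol (q : ℕ) : (A B : Type) → [Fintype A] → [DecidableEq A] →
    [Fintype B] → [DecidableEq B] → Type 1
  | output {A B : Type} [Fintype A] [DecidableEq A] [Fintype B] [DecidableEq B]
      (x : ℝ) : Protocol q A B
  | alice {A B A' : Type} [Fintype A] [DecidableEq A] [Fintype B] [DecidableEq B]
      [Fintype A'] [DecidableEq A'] {n : ℕ} (K : Fin n → Matrix A' A ℂ)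
      (hK : ∑ i, (K i)ᴴ * K i = 1) (next : Fin n → Protocol q A' B) : Protocol q A B
  | bob {A B B' : Type} [Fintype A] [DecidableEq A] [Fintype B] [DecidableEq B]
      [Fintype B'] [DecidableEq B'] {n : ℕ} (K : Fin n → Matrix B' B ℂ)
      (hK : ∑ i, (K i)ᴴ * K i = 1) (next : Fin n → Protocol q A B') : Protocol q A B
  | sendToBob {A B : Type} [Fintype A] [DecidableEq A] [Fintype B] [DecidableEq B]
      (next : Protocol q A (B × Fin q)) : Protocol q (A × Fin q) B
  | sendToAlice {A B : Type} [Fintype A] [DecidableEq A] [Fintype B] [DecidableEq B]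
      (next : Protocol q (A × Fin q) B) : Protocol q A (B × Fin q)

namespace Protocol

/-- Every run of the protocol uses exactly `m` quantum messages. -/
def UsesMessages {q : ℕ} : {A B : Type} → [Fintype A] → [DecidableEq A] →
    [Fintype B] → [DecidableEq B] → Protocol q A B → ℕ → Prop
  | _, _, _, _, _, _, output _, m => m = 0
  | _, _, _, _, _, _, alice _ _ next, m => ∀ i, (next i).UsesMessages m
  | _, _, _, _, _, _, bob _ _ next, m => ∀ i, (next i).UsesMessages m
  | _, _, _, _, _, _, sendToBob next, m => ∃ l, m = l + 1 ∧ next.UsesMessages l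
  | _, _, _, _, _, _, sendToAlice next, m => ∃ l, m = l + 1 ∧ next.UsesMessages l

/-- The law of the announced number when the joint system starts in the pure state with
amplitudes `v a b`.  Along each branch the (unnormalized) post-measurement state is carried, so
that its squared norm at a leaf is the probability of that leaf (Born's rule). -/
noncomputable def law {q : ℕ} : {A B : Type} → [Fintype A] → [DecidableEq A] →
    [Fintype B] → [DecidableEq B] → Protocol q A B → (A → B → ℂ) → MeasureTheory.Measure ℝ
  | _, _, _, _, _, _, output x, v =>
      ENNReal.ofReal (∑ a, ∑ b, ‖v a b‖ ^ 2) • MeasureTheory.Measure.dirac x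
  | _, _, _, _, _, _, alice K _ next, v =>
      ∑ i, (next i).law (fun a' b => ∑ a, K i a' a * v a b)
  | _, _, _, _, _, _, bob K _ next, v =>
      ∑ i, (next i).law (fun a b' => ∑ b, K i b' b * v a b)
  | _, _, _, _, _, _, sendToBob next, v => next.law (fun a b => v (a, b.2) b.1)
  | _, _, _, _, _, _, sendToAlice next, v => next.law (fun a b => v a.1 (b, a.2))

end Protocol

/-- The basis of `(ℂ^d)^{⊗ k}`: strings of length `k` over the basis of `ℂ^d`. -/
abbrev CopyBasis (d k : ℕ) : Type := Fin k → Fin d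

/-- The amplitudes of the joint input: `k` copies of `ψ` for Alice and `k` copies of `φ` for
Bob, i.e. `ψ^{⊗ k} ⊗ φ^{⊗ k}`. -/
noncomputable def copiesInput {d : ℕ} (k : ℕ) (ψ φ : EuclideanSpace ℂ (Fin d)) :
    CopyBasis d k → CopyBasis d k → ℂ :=
  fun x y => (∏ i, ψ (x i)) * ∏ i, φ (y i)

/-- A protocol with shared classical randomness on `k` copies of each of two `d`-dimensional
states: the parties draw a common `ω` from a probability space and then run the protocol
`protocol ω`. -/
structure SharedRandomnessProtocol (q d k : ℕ) where
  Ω : Type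
  mΩ : MeasurableSpace Ω
  μ : MeasureTheory.Measure Ω
  isProb : MeasureTheory.IsProbabilityMeasure μ
  protocol : Ω → Protocol q (CopyBasis d k) (CopyBasis d k)
  measurable_law : ∀ ψ φ : EuclideanSpace ℂ (Fin d), ‖ψ‖ = 1 → ‖φ‖ = 1 →
    Measurable fun ω => (protocol ω).law (copiesInput k ψ φ)

namespace SharedRandomnessProtocol

variable {q d k : ℕ}

/-- Every run uses exactly `m` quantum messages, whatever the shared randomness. -/
def UsesMessages (P : SharedRandomnessProtocol q d k) (m : ℕ) : Prop :=
  ∀ ω, (P.protocol ω).UsesMessages m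

/-- The law of the output when Alice holds `k` copies of `ψ` and Bob `k` copies of `φ`. -/
noncomputable def outputLaw (P : SharedRandomnessProtocol q d k)
    (ψ φ : EuclideanSpace ℂ (Fin d)) : MeasureTheory.Measure ℝ :=
  letI := P.mΩ
  P.μ.bind fun ω => (P.protocol ω).law (copiesInput k ψ φ)

end SharedRandomnessProtocol

/-! ### Sums over strings of independent symbols -/

/-! Write F for the squared overlap of ψ and φ. In each round the shared randomness picks an
orthonormal basis, cut into `d / q + 1` blocks of at most q vectors. Each party measures the block
of each of n + 1 ≈ √(d/(2q)) fresh copies, n the floor of that root, keeping the component inside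
the block. By the birthday paradox, with probability bounded below some copy of Alice and some copy
of Bob land in the same block t. Alice sends that q-dimensional register and Bob performs a SWAP
test. Given a hit in block t, the sign has mean |⟨B_t ψ, B_t φ⟩|² / (p_t r_t), where p_t and r_t are
the block probabilities. The output is the sum of the signs over successful rounds divided by the
number of such rounds.

This works because a random block acts almost like a multiple of an isometry: ⟨B_t ψ, B_t φ⟩ ≈
(l/d)⟨ψ, φ⟩ for a block with l rows, and p_t, r_t ≈ l/d by the case ψ = φ. Only second moments are
needed, so a Fourier basis with random signs and a random permutation of coordinates suffices. Its
variance is at most 2q/(d(d-1)) (`sum_norm_blockInner_sub_sq_le`), which relative to (q/d)² is of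
order 1/q, hence at most a small multiple of ε² once q is at least a large constant over ε².

The position of the collision depends on all outcomes. The bias is therefore bounded by a sum over
all pairs of positions (`abs_sum_round_error_le`, `sum_abs_round_error_le`), and the hit probability
is bounded below by the second moment method (`sum_collision_ge`, `sum_hit_ge`). Rounds, with their
seeds, are independent (`law_round`, `sum_law_rounds`), and Chebyshev's inequality for numerator and
denominator over order 1/ε² rounds finishes the argument (`sum_iid_ratio_close`). -/

theorem sum_pi_insertNth {O M : Type*} [Fintype O] [AddCommMonoid M] {n : ℕ} (i : Fin (n + 1))
    (f : (Fin (n + 1) → O) → M) :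
    ∑ a, f a = ∑ o : O, ∑ a : Fin n → O, f (i.insertNth o a) := by
  rw [← (Fin.insertNthEquiv (fun _ => O) i).sum_comp, Fintype.sum_prod_type]
  rfl

theorem sum_pi_prod {O R : Type*} [Fintype O] [CommSemiring R] {n : ℕ} (w : Fin n → O → R) :
    ∑ a : Fin n → O, ∏ i, w i (a i) = ∏ i, ∑ o, w i o := by
  classical
  rw [Finset.prod_univ_sum, Fintype.piFinset_univ]

section IID

variable {O : Type*} [Fintype O] (w : O → ℝ) (hw : ∑ o, w o = 1)
include hw

theorem sum_iid_weight (n : ℕ) : ∑ a : Fin n → O, ∏ i, w (a i) = 1 := by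
  rw [sum_pi_prod]; simp [hw]

theorem sum_iid_mean (n : ℕ) (f : O → ℝ) :
    ∑ a : Fin n → O, (∏ i, w (a i)) * ∑ i, f (a i) = n * ∑ o, w o * f o := by
  induction n with
  | zero => simp
  | succ n ih =>
    rw [sum_pi_insertNth 0]
    have h : ∀ o, ∑ a : Fin n → O, (∏ i, w ((Fin.insertNth 0 o a : Fin (n + 1) → O) i)) *
        ∑ i, f ((Fin.insertNth 0 o a : Fin (n + 1) → O) i)
        = w o * f o + w o * (n * ∑ o, w o * f o) := by
      intro o
      rw [← ih, Finset.mul_sum]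
      have h1 := sum_iid_weight w hw n
      calc _ = ∑ a : Fin n → O, ((∏ i, w (a i)) * (w o * f o) +
            w o * ((∏ i, w (a i)) * ∑ i, f (a i))) := by
            refine Finset.sum_congr rfl fun a _ => ?_
            simp only [Fin.prod_univ_succ, Fin.sum_univ_succ, Fin.insertNth_zero', Fin.cons_zero,
              Fin.cons_succ]
            ring
        _ = _ := by rw [Finset.sum_add_distrib, ← Finset.sum_mul, h1, one_mul]
    simp_rw [h]
    rw [Finset.sum_add_distrib, ← Finset.sum_mul, hw]
    push_cast; ring

/-- The n(n - 1) ordered pairs of distinct positions are independent and contribute the product of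
the means; the n diagonal pairs contribute the mean of the product. -/
theorem sum_iid_second_moment (n : ℕ) (f g : O → ℝ) :
    ∑ a : Fin n → O, (∏ i, w (a i)) * ((∑ i, f (a i)) * ∑ i, g (a i)) =
      n * (n - 1) * ((∑ o, w o * f o) * ∑ o, w o * g o) + n * ∑ o, w o * (f o * g o) := by
  induction n with
  | zero => simp
  | succ n ih =>
    rw [sum_pi_insertNth 0]
    have h : ∀ o, ∑ a : Fin n → O, (∏ i, w ((Fin.insertNth 0 o a : Fin (n + 1) → O) i)) *
        ((∑ i, f ((Fin.insertNth 0 o a : Fin (n + 1) → O) i)) *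
          ∑ i, g ((Fin.insertNth 0 o a : Fin (n + 1) → O) i))
        = w o * (f o * g o) + w o * f o * (n * ∑ o, w o * g o) +
          w o * g o * (n * ∑ o, w o * f o) + w o * (n * (n - 1) *
            ((∑ o, w o * f o) * ∑ o, w o * g o) + n * ∑ o, w o * (f o * g o)) := by
      intro o
      rw [← ih, ← sum_iid_mean w hw n f, ← sum_iid_mean w hw n g]
      have h1 := sum_iid_weight w hw n
      calc _ = ∑ a : Fin n → O, ((∏ i, w (a i)) * (w o * (f o * g o)) +
            w o * f o * ((∏ i, w (a i)) * ∑ i, g (a i)) +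
            w o * g o * ((∏ i, w (a i)) * ∑ i, f (a i)) +
            w o * ((∏ i, w (a i)) * ((∑ i, f (a i)) * ∑ i, g (a i)))) := by
            refine Finset.sum_congr rfl fun a _ => ?_
            simp only [Fin.prod_univ_succ, Fin.sum_univ_succ, Fin.insertNth_zero', Fin.cons_zero,
              Fin.cons_succ]
            ring
        _ = _ := by
            simp only [Finset.sum_add_distrib, ← Finset.sum_mul, h1, one_mul, ← Finset.mul_sum]
    simp_rw [h]
    simp only [Finset.sum_add_distrib, ← Finset.sum_mul, hw]
    push_cast; ring

theorem sum_iid_variance_le (hw0 : ∀ o, 0 ≤ w o) (m : ℕ) (f : O → ℝ) (C : ℝ)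
    (hf : ∀ o, |f o| ≤ C) :
    ∑ a : Fin m → O, (∏ i, w (a i)) * (∑ i, f (a i) - m * ∑ o, w o * f o) ^ 2 ≤ m * C ^ 2 := by
  set μ := ∑ o, w o * f o
  have hz : ∑ o, w o * (f o - μ) = 0 := by
    simp only [mul_sub, Finset.sum_sub_distrib, ← Finset.sum_mul, hw]
    simp [μ]
  have h := sum_iid_second_moment w hw m (fun o => f o - μ) (fun o => f o - μ)
  rw [hz] at h
  have h2 : ∀ a : Fin m → O, ∑ i, (f (a i) - μ) = ∑ i, f (a i) - m * μ := by
    intro a; simp [Finset.sum_sub_distrib]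
  simp only [h2, ← pow_two] at h
  rw [h]
  have h3 : ∑ o, w o * (f o - μ) ^ 2 = ∑ o, w o * f o ^ 2 - μ ^ 2 := by
    have : ∀ o, w o * (f o - μ) ^ 2 = w o * f o ^ 2 - 2 * μ * (w o * f o) + w o * μ ^ 2 := by
      intro o; ring
    simp only [this, Finset.sum_add_distrib, Finset.sum_sub_distrib, ← Finset.mul_sum,
      ← Finset.sum_mul, hw]
    change _ - 2 * μ * μ + _ = _
    ring
  have h4 : ∑ o, w o * f o ^ 2 ≤ C ^ 2 := by
    calc _ ≤ ∑ o, w o * C ^ 2 := Finset.sum_le_sum fun o _ =>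
          mul_le_mul_of_nonneg_left (sq_le_sq' (by linarith [neg_le_of_abs_le (hf o)])
            (le_of_abs_le (hf o))) (hw0 o)
      _ = _ := by rw [← Finset.sum_mul, hw, one_mul]
  rw [h3]
  have : (0:ℝ) ≤ m := Nat.cast_nonneg m
  nlinarith [sq_nonneg μ]

/-- The ratio of two empirical sums concentrates around `F` if the numerator has mean close to `F`
times the mean of the denominator. -/
theorem sum_iid_ratio_close (hw0 : ∀ o, 0 ≤ w o) (S T : O → ℝ) (F c ε δ : ℝ) (m : ℕ)
    (hF0 : 0 ≤ F) (hF1 : F ≤ 1) (hT : ∀ o, |T o| ≤ 1) (hS : ∀ o, |S o| ≤ 1)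
    (hc : 0 < c) (hε : 0 < ε) (hε1 : ε < 1) (hδ : 0 < δ)
    (hTm : c ≤ ∑ o, w o * T o) (hSm : |∑ o, w o * (S o - F * T o)| ≤ ε * c / 4)
    (hm : 68 / (δ * c ^ 2) / ε ^ 2 ≤ m) [DecidablePred fun a : Fin m → O =>
      |(∑ i, S (a i)) / (∑ i, T (a i)) - F| ≤ ε] :
    1 - δ ≤ ∑ a : Fin m → O, (∏ i, w (a i)) *
      if |(∑ i, S (a i)) / (∑ i, T (a i)) - F| ≤ ε then 1 else 0 := by
  have hm0 : (0 : ℝ) < m := lt_of_lt_of_le (by positivity) hm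
  have v1 := sum_iid_variance_le w hw hw0 m T 1 hT
  have v2 := sum_iid_variance_le w hw hw0 m (fun o => S o - F * T o) 2 (fun o => by
    have := abs_sub (S o) (F * T o)
    rw [abs_mul, abs_of_nonneg hF0] at this
    nlinarith [hS o, hT o, abs_nonneg (T o)])
  set μ := ∑ o, w o * T o
  set ν := ∑ o, w o * (S o - F * T o)
  -- Chebyshev in pointwise form: failure forces either a denominator below half of m * c, or a
  -- deviation of s - F t by more than m ε c / 4. Otherwise |s - F t| ≤ m ε c / 2 ≤ ε t, half of it
  -- from the bias ν. Each quadratic term is at least 1 in its own case.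
  have key : ∀ a : Fin m → O, 1 - (∑ i, T (a i) - m * μ) ^ 2 * (4 / (m * c) ^ 2) -
      (∑ i, (S (a i) - F * T (a i)) - m * ν) ^ 2 * (16 / (m * ε * c) ^ 2) ≤
      if |(∑ i, S (a i)) / (∑ i, T (a i)) - F| ≤ ε then 1 else 0 := by
    intro a
    set t := ∑ i, T (a i)
    set s := ∑ i, S (a i)
    have hs : ∑ i, (S (a i) - F * T (a i)) = s - F * t := by
      simp [Finset.sum_sub_distrib, Finset.mul_sum, s, t]
    rw [hs]
    split_ifs with hgood
    · have h1 : 0 ≤ (t - m * μ) ^ 2 * (4 / (m * c) ^ 2) := by positivity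
      have h2 : 0 ≤ (s - F * t - m * ν) ^ 2 * (16 / (m * ε * c) ^ 2) := by positivity
      linarith
    · have h1 : 0 ≤ (t - m * μ) ^ 2 * (4 / (m * c) ^ 2) := by positivity
      have h2 : 0 ≤ (s - F * t - m * ν) ^ 2 * (16 / (m * ε * c) ^ 2) := by positivity
      by_cases ht : t < m * c / 2
      · have : 1 ≤ (t - m * μ) ^ 2 * (4 / (m * c) ^ 2) := by
          rw [mul_div_assoc', le_div_iff₀ (by positivity)]
          have : m * c / 2 ≤ m * μ - t := by nlinarith
          have : (m * c / 2) ^ 2 ≤ (m * μ - t) ^ 2 := pow_le_pow_left₀ (by positivity) this 2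
          nlinarith
        linarith
      · push Not at ht
        have htp : 0 < t := lt_of_lt_of_le (by positivity) ht
        by_cases hx : |s - F * t - m * ν| ≤ m * ε * c / 4
        · exfalso
          apply hgood
          have h5 : s / t - F = (s - F * t) / t := by field_simp
          rw [h5, abs_div, abs_of_pos htp, div_le_iff₀ htp]
          have h6 : |s - F * t| ≤ |s - F * t - m * ν| + |m * ν| := by
            simpa using abs_add_le (s - F * t - m * ν) (m * ν)
          rw [abs_mul, abs_of_pos hm0] at h6
          have h7 : m * |ν| ≤ m * (ε * c / 4) := mul_le_mul_of_nonneg_left hSm hm0.le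
          have h8 : ε * (m * c / 2) ≤ ε * t := mul_le_mul_of_nonneg_left ht hε.le
          linarith
        · push Not at hx
          have : 1 ≤ (s - F * t - m * ν) ^ 2 * (16 / (m * ε * c) ^ 2) := by
            rw [mul_div_assoc', le_div_iff₀ (by positivity)]
            have : (m * ε * c / 4) ^ 2 ≤ |s - F * t - m * ν| ^ 2 :=
              pow_le_pow_left₀ (by positivity) hx.le 2
            rw [sq_abs] at this
            nlinarith
          linarith
  calc 1 - δ ≤ 1 - m * 1 ^ 2 * (4 / (m * c) ^ 2) - m * 2 ^ 2 * (16 / (m * ε * c) ^ 2) := by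
        -- The variances m and 4m of the two sums give 4 ε² + 64 ≤ 68, the constant in `hm`.
        have h1 : (m : ℝ) * 1 ^ 2 * (4 / (m * c) ^ 2) + m * 2 ^ 2 * (16 / (m * ε * c) ^ 2) =
            (4 * ε ^ 2 + 64) / (m * ε ^ 2 * c ^ 2) := by field_simp; norm_num
        have h2 : (4 * ε ^ 2 + 64) / (m * ε ^ 2 * c ^ 2) ≤ δ := by
          rw [div_le_iff₀ (by positivity)]
          rw [div_div, div_le_iff₀ (by positivity)] at hm
          nlinarith
        linarith
    _ ≤ ∑ a : Fin m → O, (∏ i, w (a i)) * (1 - (∑ i, T (a i) - m * μ) ^ 2 * (4 / (m * c) ^ 2) -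
      (∑ i, (S (a i) - F * T (a i)) - m * ν) ^ 2 * (16 / (m * ε * c) ^ 2)) := by
        simp only [mul_sub, Finset.sum_sub_distrib, mul_one, ← mul_assoc, ← Finset.sum_mul]
        simp only [Finset.sum_sub_distrib] at v2
        rw [sum_iid_weight w hw]
        gcongr
    _ ≤ _ := Finset.sum_le_sum fun a _ =>
        mul_le_mul_of_nonneg_left (key a) (Finset.prod_nonneg fun i _ => hw0 _)

end IID

theorem sum_sum_mul_separable {α β γ : Type*} [Fintype α] [Fintype β] (G : Finset γ)
    (P : α → ℝ) (R : β → ℝ) (f : γ → α → ℝ) (g : γ → β → ℝ) :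
    ∑ a, ∑ b, P a * R b * ∑ x ∈ G, f x a * g x b =
      ∑ x ∈ G, (∑ a, P a * f x a) * ∑ b, R b * g x b := by
  simp_rw [Finset.sum_mul_sum]
  symm
  rw [Finset.sum_comm]
  refine Finset.sum_congr rfl fun a _ => ?_
  rw [Finset.sum_comm]
  refine Finset.sum_congr rfl fun b _ => ?_
  rw [Finset.mul_sum]
  exact Finset.sum_congr rfl fun x _ => by ring

/-- Lower bound on the probability that two strings of independent symbols share a symbol. -/
theorem sum_collision_ge {O : Type*} [Fintype O] [DecidableEq O] (p r : O → ℝ)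
    (hp : ∑ o, p o = 1) (hr : ∑ o, r o = 1) (hp0 : ∀ o, 0 ≤ p o) (hr0 : ∀ o, 0 ≤ r o)
    (G : Finset O) (τ : ℝ) (hpτ : ∀ x ∈ G, p x ≤ τ) (hrτ : ∀ x ∈ G, r x ≤ τ)
    (n : ℕ) (hτ : (n : ℝ) ^ 2 * τ ≤ 1) :
    (n + 1 : ℝ) ^ 2 / 4 * ∑ x ∈ G, p x * r x ≤
      ∑ a : Fin (n + 1) → O, ∑ b : Fin (n + 1) → O, (∏ i, p (a i)) * (∏ j, r (b j)) *
        if ∃ i j, a i = b j then 1 else 0 := by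
  set s := ∑ x ∈ G, p x * r x
  let I : O → O → ℝ := fun x o => if o = x then 1 else 0
  let A : O → (Fin (n + 1) → O) → ℝ := fun x a => ∑ i, I x (a i)
  have hI : ∀ (v : O → ℝ) x, ∑ o, v o * I x o = v x := by intro v x; simp [I]
  have hII : ∀ (v : O → ℝ) x y, ∑ o, v o * (I x o * I y o) = if x = y then v x else 0 := by
    intro v x y
    have h : ∀ o, v o * (I x o * I y o) = v o * I y o * I x o := fun o => by ring
    simp only [h]
    rw [hI (fun o => v o * I y o) x]
    simp [I]
  have mean : ∀ (v : O → ℝ) (_ : ∑ o, v o = 1) x,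
      ∑ a : Fin (n + 1) → O, (∏ i, v (a i)) * A x a = (n + 1) * v x := by
    intro v hv x
    rw [sum_iid_mean v hv, hI]; push_cast; ring
  have second : ∀ (v : O → ℝ) (_ : ∑ o, v o = 1) x y,
      ∑ a : Fin (n + 1) → O, (∏ i, v (a i)) * (A x a * A y a) =
        (n + 1) * n * (v x * v y) + (n + 1) * if x = y then v x else 0 := by
    intro v hv x y
    rw [sum_iid_second_moment v hv, hI, hI, hII]; push_cast; ring
  -- Z counts the pairs of positions that carry the same symbol of G. Since Z/2 - Z²/16 = 1 - (Z/4 -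
  -- 1)² is at most 1 and vanishes at Z = 0, it lies below the collision indicator.
  let Z : (Fin (n + 1) → O) → (Fin (n + 1) → O) → ℝ := fun a b => ∑ x ∈ G, A x a * A x b
  have hZ1 : ∑ a : Fin (n + 1) → O, ∑ b : Fin (n + 1) → O,
      (∏ i, p (a i)) * (∏ j, r (b j)) * Z a b = (n + 1) ^ 2 * s := by
    rw [sum_sum_mul_separable]
    simp only [mean p hp, mean r hr, s, Finset.mul_sum]
    exact Finset.sum_congr rfl fun x _ => by ring
  have hs0 : 0 ≤ s := Finset.sum_nonneg fun x _ => mul_nonneg (hp0 x) (hr0 x)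
  have hZ2 : ∑ a : Fin (n + 1) → O, ∑ b : Fin (n + 1) → O,
      (∏ i, p (a i)) * (∏ j, r (b j)) * Z a b ^ 2 ≤ 4 * ((n + 1) ^ 2 * s) := by
    have hsq : ∀ a b, Z a b ^ 2 = ∑ e ∈ G ×ˢ G, (A e.1 a * A e.2 a) * (A e.1 b * A e.2 b) := by
      intro a b
      rw [pow_two, Finset.sum_mul_sum, Finset.sum_product]
      exact Finset.sum_congr rfl fun x _ => Finset.sum_congr rfl fun y _ => by ring
    simp only [hsq]
    rw [sum_sum_mul_separable]
    simp only [second p hp, second r hr]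
    rw [Finset.sum_product, Finset.mul_sum, Finset.mul_sum]
    refine Finset.sum_le_sum fun x hx => ?_
    have hτ0 : 0 ≤ τ := (hp0 x).trans (hpτ x hx)
    have hsτ : s ≤ τ := by
      calc s ≤ ∑ y ∈ G, p y * τ := Finset.sum_le_sum fun y hy =>
            mul_le_mul_of_nonneg_left (hrτ y hy) (hp0 y)
        _ ≤ ∑ y, p y * τ := Finset.sum_le_sum_of_subset_of_nonneg (Finset.subset_univ _)
            fun y _ _ => mul_nonneg (hp0 y) hτ0
        _ = τ := by rw [← Finset.sum_mul, hp, one_mul]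
    have hnτ : (n : ℝ) * τ ≤ 1 := by
      have : (n : ℝ) ≤ (n : ℝ) ^ 2 := by exact_mod_cast Nat.le_self_pow two_ne_zero n
      nlinarith
    have hterm : ∀ y, ((n + 1 : ℝ) * n * (p x * p y) + (n + 1) * if x = y then p x else 0) *
        ((n + 1) * n * (r x * r y) + (n + 1) * if x = y then r x else 0) =
        (n + 1) ^ 2 * (p x * r x) * (n ^ 2 * (p y * r y)) +
        (n + 1) ^ 2 * if x = y then (n * (p x * p x * r x) + n * (p x * (r x * r x)) + p x * r x)
          else 0 := by
      intro y
      by_cases h : x = y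
      · subst h; simp only [if_true]; ring
      · simp only [if_neg h]; ring
    simp only [hterm, Finset.sum_add_distrib, ← Finset.mul_sum, Finset.sum_ite_eq, hx, if_true]
    have hpr : 0 ≤ p x * r x := mul_nonneg (hp0 x) (hr0 x)
    have h1 : (n : ℝ) ^ 2 * s ≤ 1 := le_trans (by gcongr) hτ
    have h2 : (n : ℝ) * p x ≤ 1 := le_trans (by gcongr; exact hpτ x hx) hnτ
    have h3 : (n : ℝ) * r x ≤ 1 := le_trans (by gcongr; exact hrτ x hx) hnτ
    -- The four summands come from two disjoint pairs of positions, a shared position on one side or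
    -- on the other, and the same pair twice; each is at most 1. Only n² τ ≤ 1 is needed, not (n +
    -- 1)² τ ≤ 1, which lets n be a rounded-down square root.
    calc _ = (n + 1 : ℝ) ^ 2 * (p x * r x * (n ^ 2 * s + n * p x + n * r x + 1)) := by
          simp only [s]; ring
      _ ≤ (n + 1 : ℝ) ^ 2 * (p x * r x * 4) := by gcongr; linarith
      _ = _ := by ring
  calc (n + 1 : ℝ) ^ 2 / 4 * s = (n + 1) ^ 2 * s / 2 - 4 * ((n + 1) ^ 2 * s) / 16 := by ring
    _ ≤ ∑ a : Fin (n + 1) → O, ∑ b : Fin (n + 1) → O,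
        ((∏ i, p (a i)) * (∏ j, r (b j)) * Z a b / 2 -
          (∏ i, p (a i)) * (∏ j, r (b j)) * Z a b ^ 2 / 16) := by
        simp only [Finset.sum_sub_distrib, ← Finset.sum_div]
        rw [hZ1]
        linarith
    _ ≤ _ := by
        refine Finset.sum_le_sum fun a _ => Finset.sum_le_sum fun b _ => ?_
        have hw : 0 ≤ (∏ i, p (a i)) * ∏ j, r (b j) :=
          mul_nonneg (Finset.prod_nonneg fun i _ => hp0 _) (Finset.prod_nonneg fun i _ => hr0 _)
        have hZ : Z a b / 2 - Z a b ^ 2 / 16 ≤ if ∃ i j, a i = b j then 1 else 0 := by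
          split_ifs with h
          · nlinarith [sq_nonneg (Z a b / 4 - 1)]
          · have : Z a b = 0 := by
              refine Finset.sum_eq_zero fun x _ => ?_
              by_contra hne
              obtain ⟨h1, h2⟩ := mul_ne_zero_iff.mp hne
              obtain ⟨i, -, hi⟩ := Finset.exists_ne_zero_of_sum_ne_zero h1
              obtain ⟨j, -, hj⟩ := Finset.exists_ne_zero_of_sum_ne_zero h2
              have hi' : a i = x := by by_contra hc; exact hi (if_neg hc)
              have hj' : b j = x := by by_contra hc; exact hj (if_neg hc)
              exact h ⟨i, j, hi'.trans hj'.symm⟩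
            rw [this]; norm_num
        nlinarith [mul_le_mul_of_nonneg_left hZ hw]

/-- The mean of a function of the symbol at a fixed pair of positions where two strings agree. -/
theorem sum_agree_eq {O : Type*} [Fintype O] [DecidableEq O] (p r h : O → ℝ)
    (hp : ∑ o, p o = 1) (hr : ∑ o, r o = 1) {n : ℕ} (i j : Fin (n + 1)) :
    ∑ a : Fin (n + 1) → O, ∑ b : Fin (n + 1) → O,
      (if a i = b j then (∏ i', p (a (i.succAbove i'))) * (∏ j', r (b (j.succAbove j'))) * h (a i)
        else 0) = ∑ x, h x := by
  rw [sum_pi_insertNth i]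
  simp_rw [sum_pi_insertNth (n := n) j]
  simp only [Fin.insertNth_apply_same, Fin.insertNth_apply_succAbove]
  refine Finset.sum_congr rfl fun x _ => ?_
  have hx : ∀ a : Fin n → O, ∑ y, ∑ b : Fin n → O,
      (if x = y then (∏ i', p (a i')) * (∏ j', r (b j')) * h x else 0) =
      (∏ i', p (a i')) * h x := by
    intro a
    rw [Finset.sum_eq_single x (by intro y _ hy; simp [hy.symm]) (by simp)]
    simp only [if_true, ← Finset.sum_mul, ← Finset.mul_sum, sum_iid_weight r hr, mul_one]
  simp only [hx, ← Finset.sum_mul, sum_iid_weight p hp, one_mul]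

/-! ### Local operations on product states -/

namespace Protocol

section Local

set_option linter.unusedSectionVars false

variable {q : ℕ} {A B A' B' R X Y I C : Type} [Fintype A] [DecidableEq A] [Fintype B]
  [DecidableEq B] [Fintype A'] [DecidableEq A'] [Fintype B'] [DecidableEq B'] [Fintype R]
  [DecidableEq R] [Fintype X] [DecidableEq X] [Fintype Y] [DecidableEq Y] [Fintype I]
  [Fintype C] [DecidableEq C]

/-- The law of the output scales with the squared norm of the state. -/
theorem law_const_mul (P : Protocol q A B) (c : ℂ) (v : A → B → ℂ) :
    P.law (fun a b => c * v a b) = ENNReal.ofReal (‖c‖ ^ 2) • P.law v := by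
  induction P with
  | output x =>
    simp only [law, norm_mul, mul_pow, ← Finset.mul_sum]
    rw [ENNReal.ofReal_mul (by positivity), mul_smul]
  | alice K hK next ih =>
    simp only [law, mul_left_comm _ c, ← Finset.mul_sum, Finset.smul_sum]
    exact Finset.sum_congr rfl fun i _ => ih i _
  | bob K hK next ih =>
    simp only [law, mul_left_comm _ c, ← Finset.mul_sum, Finset.smul_sum]
    exact Finset.sum_congr rfl fun i _ => ih i _
  | sendToBob next ih => simp only [law]; exact ih _
  | sendToAlice next ih => simp only [law]; exact ih _

/-- The matrix acting as `L` on the second factor of `A ≃ R × X` and as the identity on the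
first one. -/
def localKraus (e : A ≃ R × X) (e' : A' ≃ R × Y) (L : Matrix Y X ℂ) : Matrix A' A ℂ :=
  fun a' a => if (e' a').1 = (e a).1 then L (e' a').2 (e a).2 else 0

theorem sum_localKraus (e : A ≃ R × X) (e' : A' ≃ R × Y) (L : I → Matrix Y X ℂ)
    (hL : ∑ i, (L i)ᴴ * L i = 1) :
    ∑ i, (localKraus e e' (L i))ᴴ * localKraus e e' (L i) = 1 := by
  ext a₁ a₂
  have h := congrFun (congrFun hL (e a₁).2) (e a₂).2
  simp only [Matrix.sum_apply, Matrix.mul_apply, Matrix.conjTranspose_apply] at h ⊢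
  have h2 : ∀ i, ∑ a', star (localKraus e e' (L i) a' a₁) * localKraus e e' (L i) a' a₂ =
      if (e a₁).1 = (e a₂).1 then ∑ y, star (L i y (e a₁).2) * L i y (e a₂).2 else 0 := by
    intro i
    rw [← e'.symm.sum_comp, Fintype.sum_prod_type]
    simp only [localKraus, Equiv.apply_symm_apply]
    rw [Finset.sum_eq_single (e a₁).1 (by intro y _ hy; simp [hy]) (by simp)]
    by_cases hr : (e a₁).1 = (e a₂).1 <;> simp [hr]
  simp only [h2]
  by_cases hr : (e a₁).1 = (e a₂).1
  · simp only [hr, if_true, h]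
    simp only [Matrix.one_apply]
    congr 1
    rw [← e.injective.eq_iff, Prod.ext_iff]
    simp [hr]
  · have : a₁ ≠ a₂ := fun h => hr (by rw [h])
    simp [hr, this]

theorem localKraus_mul_prod (e : A ≃ R × X) (e' : A' ≃ R × Y) (L : Matrix Y X ℂ) (x : R → ℂ)
    (γ : X → ℂ) (a' : A') :
    ∑ a, localKraus e e' L a' a * (x (e a).1 * γ (e a).2) =
      x (e' a').1 * (L *ᵥ γ) (e' a').2 := by
  rw [← e.symm.sum_comp, Fintype.sum_prod_type]
  simp only [localKraus, Equiv.apply_symm_apply]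
  rw [Finset.sum_eq_single (e' a').1 (by intro y _ hy; simp [hy.symm]) (by simp)]
  simp only [if_true, Matrix.mulVec, dotProduct, Finset.mul_sum]
  exact Finset.sum_congr rfl fun y _ => by ring

theorem sum_fin_card {M : Type*} [AddCommMonoid M] (f : I → M) :
    ∑ i, f ((Fintype.equivFin I).symm i) = ∑ i, f i :=
  (Fintype.equivFin I).symm.sum_comp f

/-- Alice measures the factor `X` of her system. -/
noncomputable def aliceOn (e : A ≃ R × X) (e' : A' ≃ R × Y) (L : I → Matrix Y X ℂ)
    (hL : ∑ i, (L i)ᴴ * L i = 1) (next : I → Protocol q A' B) : Protocol q A B :=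
  .alice (fun i => localKraus e e' (L ((Fintype.equivFin I).symm i)))
    ((sum_fin_card fun i => (localKraus e e' (L i))ᴴ * localKraus e e' (L i)).trans
      (sum_localKraus e e' L hL))
    fun i => next ((Fintype.equivFin I).symm i)

/-- Bob measures the factor `X` of his system. -/
noncomputable def bobOn (e : B ≃ R × X) (e' : B' ≃ R × Y) (L : I → Matrix Y X ℂ)
    (hL : ∑ i, (L i)ᴴ * L i = 1) (next : I → Protocol q A B') : Protocol q A B :=
  .bob (fun i => localKraus e e' (L ((Fintype.equivFin I).symm i)))
    ((sum_fin_card fun i => (localKraus e e' (L i))ᴴ * localKraus e e' (L i)).trans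
      (sum_localKraus e e' L hL))
    fun i => next ((Fintype.equivFin I).symm i)

theorem usesMessages_aliceOn (e : A ≃ R × X) (e' : A' ≃ R × Y) (L : I → Matrix Y X ℂ)
    (hL : ∑ i, (L i)ᴴ * L i = 1) (next : I → Protocol q A' B) (m : ℕ)
    (h : ∀ i, (next i).UsesMessages m) : (aliceOn e e' L hL next).UsesMessages m :=
  fun _ => h _

theorem usesMessages_bobOn (e : B ≃ R × X) (e' : B' ≃ R × Y) (L : I → Matrix Y X ℂ)
    (hL : ∑ i, (L i)ᴴ * L i = 1) (next : I → Protocol q A B') (m : ℕ)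
    (h : ∀ i, (next i).UsesMessages m) : (bobOn e e' L hL next).UsesMessages m :=
  fun _ => h _

theorem law_aliceOn (e : A ≃ R × X) (e' : A' ≃ R × Y) (L : I → Matrix Y X ℂ)
    (hL : ∑ i, (L i)ᴴ * L i = 1) (next : I → Protocol q A' B) (x : R → ℂ) (γ : X → ℂ)
    (β : B → ℂ) :
    (aliceOn e e' L hL next).law (fun a b => x (e a).1 * γ (e a).2 * β b) =
      ∑ i, (next i).law (fun a' b => x (e' a').1 * (L i *ᵥ γ) (e' a').2 * β b) := by
  have h : ∀ (i : I) (a' : A') (b : B), ∑ a, localKraus e e' (L i) a' a * (x (e a).1 * γ (e a).2 * β b) =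
      x (e' a').1 * (L i *ᵥ γ) (e' a').2 * β b := by
    intro i a' b
    rw [← localKraus_mul_prod e e', Finset.sum_mul]
    exact Finset.sum_congr rfl fun a _ => by ring
  simp only [aliceOn, law, h]
  exact sum_fin_card fun i => (next i).law (fun a' b => x (e' a').1 * (L i *ᵥ γ) (e' a').2 * β b)

theorem law_bobOn (e : B ≃ R × X) (e' : B' ≃ R × Y) (L : I → Matrix Y X ℂ)
    (hL : ∑ i, (L i)ᴴ * L i = 1) (next : I → Protocol q A B') (x : R → ℂ) (γ : X → ℂ)
    (α : A → ℂ) :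
    (bobOn e e' L hL next).law (fun a b => α a * (x (e b).1 * γ (e b).2)) =
      ∑ i, (next i).law (fun a b' => α a * (x (e' b').1 * (L i *ᵥ γ) (e' b').2)) := by
  simp only [bobOn, law]
  simp only [mul_left_comm _ (α _), ← Finset.mul_sum]
  simp only [localKraus_mul_prod]
  exact sum_fin_card fun i => (next i).law
    (fun a b' => α a * (x (e' b').1 * (L i *ᵥ γ) (e' b').2))

/-- The row vector of the basis state `c`. -/
def basisBra (c : C) : Matrix Unit C ℂ := fun _ x => if x = c then 1 else 0

theorem sum_basisBra : ∑ c : C, (basisBra c)ᴴ * basisBra c = 1 := by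
  ext x y
  simp [basisBra, Matrix.sum_apply, Matrix.mul_apply, Matrix.one_apply, apply_ite, eq_comm]

theorem basisBra_mulVec (c : C) (γ : C → ℂ) (u : Unit) : (basisBra c *ᵥ γ) u = γ c := by
  simp [basisBra, Matrix.mulVec, dotProduct]

/-- Alice discards the factor `C` of her system. -/
noncomputable def discardAlice (e : A ≃ R × C) (next : Protocol q R B) : Protocol q A B :=
  aliceOn e (Equiv.prodUnique R Unit).symm basisBra sum_basisBra fun _ => next

/-- Bob discards the factor `C` of his system. -/
noncomputable def discardBob (e : B ≃ R × C) (next : Protocol q A R) : Protocol q A B :=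
  bobOn e (Equiv.prodUnique R Unit).symm basisBra sum_basisBra fun _ => next

/-- A discarded factor of a product state only multiplies the amplitude by the scalar γ c in each
outcome c, so the outcomes together contribute its squared norm. -/
theorem law_discardAlice (e : A ≃ R × C) (next : Protocol q R B) (x : R → ℂ) (γ : C → ℂ)
    (β : B → ℂ) :
    (discardAlice e next).law (fun a b => x (e a).1 * γ (e a).2 * β b) =
      ENNReal.ofReal (∑ c, ‖γ c‖ ^ 2) • next.law (fun a b => x a * β b) := by
  rw [discardAlice, law_aliceOn, ENNReal.ofReal_sum_of_nonneg fun _ _ => by positivity,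
    Finset.sum_smul]
  refine Finset.sum_congr rfl fun c _ => ?_
  rw [← law_const_mul]
  congr 1
  funext a b
  simp only [basisBra_mulVec]
  simp only [Equiv.prodUnique_symm_apply]
  ring

theorem law_discardBob (e : B ≃ R × C) (next : Protocol q A R) (x : R → ℂ) (γ : C → ℂ)
    (α : A → ℂ) :
    (discardBob e next).law (fun a b => α a * (x (e b).1 * γ (e b).2)) =
      ENNReal.ofReal (∑ c, ‖γ c‖ ^ 2) • next.law (fun a b => α a * x b) := by
  rw [discardBob, law_bobOn, ENNReal.ofReal_sum_of_nonneg fun _ _ => by positivity,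
    Finset.sum_smul]
  refine Finset.sum_congr rfl fun c _ => ?_
  rw [← law_const_mul]
  congr 1
  funext a b
  simp only [basisBra_mulVec]
  simp only [Equiv.prodUnique_symm_apply]
  ring

/-- The sign announced by an outcome of the SWAP test. -/
def swapSign (s : Bool) : ℝ := if s then 1 else -1

/-- The Kraus operators of the SWAP test followed by a measurement of both registers. -/
noncomputable def swapBra (i : Bool × (C × C)) : Matrix Unit (C × C) ℂ :=
  fun _ w => ((if w = i.2 then 1 else 0) + swapSign i.1 * if w = i.2.swap then 1 else 0) / 2

/-- These are the rows of (1 ± SWAP)/2. Summing over the sign cancels the cross terms, and the two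
remaining squares each sum to half of the identity because swapping permutes the basis. -/
theorem sum_swapBra : ∑ i : Bool × (C × C), (swapBra i)ᴴ * swapBra i = 1 := by
  ext v w
  have hs : ∀ x i : C × C, (x = i.swap) = (i = x.swap) := by
    intro x i
    rw [eq_iff_iff]
    constructor <;> rintro rfl <;> simp
  have hstar : ∀ (P : Prop) [Decidable P], star (if P then (1 : ℂ) else 0) = if P then 1 else 0 := by
    intro P _; split_ifs <;> simp
  simp only [Matrix.sum_apply, Matrix.mul_apply, Matrix.conjTranspose_apply, swapBra,
    Fintype.sum_prod_type (α₁ := Bool), Fintype.sum_bool, swapSign, ← Finset.sum_add_distrib,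
    Finset.univ_unique, Finset.sum_singleton]
  calc _ = ∑ i : C × C, ((if i = v then (if w = v then 1 else 0) else 0) / 2 +
        (if i = v.swap then (if w = v then 1 else 0) else 0) / 2 : ℂ) := by
        refine Finset.sum_congr rfl fun i _ => ?_
        have h1 : (if i = v then (if w = v then (1 : ℂ) else 0) else 0) =
            (if v = i then 1 else 0) * if w = i then 1 else 0 := by
          by_cases h : i = v
          · subst h; simp
          · simp [h, Ne.symm h]
        have h2 : (if i = v.swap then (if w = v then (1 : ℂ) else 0) else 0) =
            (if v = i.swap then 1 else 0) * if w = i.swap then 1 else 0 := by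
          simp only [hs v i]
          by_cases h : i = v.swap
          · subst h; simp
          · simp [h]
        rw [h1, h2]
        simp only [star_div₀, star_add, star_mul', hstar, if_true, Bool.false_eq_true, if_false,
          Complex.ofReal_one, Complex.ofReal_neg, star_one, star_neg, star_ofNat]
        ring
    _ = _ := by
        rw [Finset.sum_add_distrib, ← Finset.sum_div, ← Finset.sum_div]
        simp only [Finset.sum_ite_eq', Finset.mem_univ, if_true, Matrix.one_apply]
        simp only [eq_comm (a := w)]
        ring

theorem swapBra_mulVec (i : Bool × (C × C)) (f g : C → ℂ) (u : Unit) :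
    (swapBra i *ᵥ fun w => f w.1 * g w.2) u =
      (f i.2.1 * g i.2.2 + swapSign i.1 * (f i.2.2 * g i.2.1)) / 2 := by
  simp only [swapBra, Matrix.mulVec, dotProduct, div_mul_eq_mul_div, add_mul, mul_assoc, ite_mul,
    one_mul, zero_mul]
  rw [← Finset.sum_div, Finset.sum_add_distrib, ← Finset.mul_sum]
  simp

/-- The two pure terms of the expanded square agree after relabelling the pair, and the cross term
factors into an inner product times its conjugate. -/
theorem sum_norm_sq_swap (f g : C → ℂ) (s : Bool) :
    ∑ i : C × C, ‖(f i.1 * g i.2 + swapSign s * (f i.2 * g i.1)) / 2‖ ^ 2 =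
      ((∑ y, ‖f y‖ ^ 2) * (∑ y, ‖g y‖ ^ 2) + swapSign s * ‖∑ y, star (g y) * f y‖ ^ 2) / 2 := by
  have hσ : swapSign s ^ 2 = 1 := by cases s <;> simp [swapSign]
  have key : ∀ i : C × C, ‖(f i.1 * g i.2 + swapSign s * (f i.2 * g i.1)) / 2‖ ^ 2 =
      (‖f i.1‖ ^ 2 * ‖g i.2‖ ^ 2 + ‖f i.2‖ ^ 2 * ‖g i.1‖ ^ 2 + 2 * swapSign s *
        ((star (g i.1) * f i.1) * star (star (g i.2) * f i.2)).re) / 4 := by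
    intro i
    simp only [Complex.sq_norm, Complex.normSq_apply, Complex.star_def, Complex.mul_re,
      Complex.mul_im, Complex.add_re, Complex.add_im, Complex.ofReal_re, Complex.ofReal_im,
      Complex.conj_re, Complex.conj_im, map_mul, Complex.conj_conj, Complex.div_ofNat_re,
      Complex.div_ofNat_im]
    linear_combination (((f i.2).re * (g i.1).re - (f i.2).im * (g i.1).im) ^ 2 +
      ((f i.2).re * (g i.1).im + (f i.2).im * (g i.1).re) ^ 2) / 4 * hσ
  simp only [key]
  rw [← Finset.sum_div, Finset.sum_add_distrib, Finset.sum_add_distrib, ← Finset.mul_sum]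
  have h1 : ∑ i : C × C, ‖f i.1‖ ^ 2 * ‖g i.2‖ ^ 2 = (∑ y, ‖f y‖ ^ 2) * ∑ y, ‖g y‖ ^ 2 := by
    rw [Fintype.sum_prod_type, Finset.sum_mul_sum]
  have h2 : ∑ i : C × C, ‖f i.2‖ ^ 2 * ‖g i.1‖ ^ 2 = (∑ y, ‖f y‖ ^ 2) * ∑ y, ‖g y‖ ^ 2 := by
    rw [Fintype.sum_prod_type_right, Finset.sum_mul_sum]
  have h3 : ∑ i : C × C, ((star (g i.1) * f i.1) * star (star (g i.2) * f i.2)).re =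
      ‖∑ y, star (g y) * f y‖ ^ 2 := by
    rw [← Complex.re_sum, Fintype.sum_prod_type]
    dsimp only
    rw [← Finset.sum_mul_sum, ← star_sum, Complex.star_def, Complex.mul_conj, Complex.ofReal_re,
      Complex.sq_norm]
  rw [h1, h2, h3]
  ring

/-- Bob performs a SWAP test on the last two factors of his system and discards them. -/
noncomputable def swapTest (next : Bool → Protocol q A R) : Protocol q A ((R × C) × C) :=
  bobOn (Equiv.prodAssoc R C C) (Equiv.prodUnique R Unit).symm swapBra sum_swapBra
    fun i => next i.1

theorem law_swapTest (next : Bool → Protocol q A R) (α : A → ℂ) (x : R → ℂ) (f g : C → ℂ) :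
    (swapTest next).law (fun a b => α a * (x b.1.1 * f b.1.2 * g b.2)) =
      ∑ s, ENNReal.ofReal (((∑ y, ‖f y‖ ^ 2) * (∑ y, ‖g y‖ ^ 2) +
        swapSign s * ‖∑ y, star (g y) * f y‖ ^ 2) / 2) •
          (next s).law (fun a b => α a * x b) := by
  have h := law_bobOn (Equiv.prodAssoc R C C) (Equiv.prodUnique R Unit).symm swapBra sum_swapBra
    (fun i : Bool × (C × C) => next i.1) x (fun w => f w.1 * g w.2) α
  simp only [swapBra_mulVec, Equiv.prodAssoc_apply, ← mul_assoc] at h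
  simp only [swapTest, ← mul_assoc]
  rw [h, Fintype.sum_prod_type]
  refine Finset.sum_congr rfl fun s _ => ?_
  rw [← sum_norm_sq_swap, ENNReal.ofReal_sum_of_nonneg fun _ _ => by positivity, Finset.sum_smul]
  refine Finset.sum_congr rfl fun i _ => ?_
  rw [← law_const_mul]
  congr 1
  funext a b
  simp only [Equiv.prodUnique_symm_apply]
  ring

end Local

end Protocol

/-! ### The rounds of the protocol and the law of their outcomes -/

namespace Protocol

section Batch

variable {q d k N n : ℕ}

/-- The tensor product of the Kraus operators with outcomes `a`. -/
def tensorKraus (B : Fin N → Matrix (Fin q) (Fin d) ℂ) (a : Fin n → Fin N) :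
    Matrix (Fin n → Fin q) (Fin n → Fin d) ℂ :=
  fun y x => ∏ i, B (a i) (y i) (x i)

theorem sum_tensorKraus (B : Fin N → Matrix (Fin q) (Fin d) ℂ) (hB : ∑ t, (B t)ᴴ * B t = 1) :
    ∑ a : Fin n → Fin N, (tensorKraus B a)ᴴ * tensorKraus B a = 1 := by
  ext x x'
  have h : ∀ i, ∑ t, ∑ y, star (B t y (x i)) * B t y (x' i) = if x i = x' i then 1 else 0 := by
    intro i
    have := congrFun (congrFun hB (x i)) (x' i)
    simpa only [Matrix.sum_apply, Matrix.mul_apply, Matrix.conjTranspose_apply,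
      Matrix.one_apply] using this
  simp only [Matrix.sum_apply, Matrix.mul_apply, Matrix.conjTranspose_apply, tensorKraus,
    star_prod, ← Finset.prod_mul_distrib]
  have h2 : ∀ a : Fin n → Fin N, ∑ y : Fin n → Fin q,
      ∏ i, (star (B (a i) (y i) (x i)) * B (a i) (y i) (x' i)) =
      ∏ i, ∑ y, star (B (a i) y (x i)) * B (a i) y (x' i) := fun a =>
    sum_pi_prod fun i y => star (B (a i) y (x i)) * B (a i) y (x' i)
  simp only [h2]
  rw [sum_pi_prod fun i t => ∑ y, star (B t y (x i)) * B t y (x' i)]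
  simp only [h, Matrix.one_apply, Finset.prod_ite_zero, Finset.prod_const_one, Finset.mem_univ,
    true_implies, funext_iff]

theorem tensorKraus_mulVec_prod (B : Fin N → Matrix (Fin q) (Fin d) ℂ) (a : Fin n → Fin N)
    (ψ : Fin d → ℂ) (y : Fin n → Fin q) :
    (tensorKraus B a *ᵥ fun x => ∏ i, ψ (x i)) y = ∏ i, (B (a i) *ᵥ ψ) (y i) := by
  simp only [tensorKraus, Matrix.mulVec, dotProduct, ← Finset.prod_mul_distrib]
  exact sum_pi_prod fun i x => B (a i) (y i) x * ψ x

/-- The last `n` of `k + n` copies are set apart. -/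
def splitCopies (d k n : ℕ) : CopyBasis d (k + n) ≃ CopyBasis d k × CopyBasis d n :=
  (Fin.appendEquiv k n).symm

/-- The register at position `i` is set apart. -/
def pickRegister (R : Type) (q : ℕ) (i : Fin (n + 1)) :
    R × (Fin (n + 1) → Fin q) ≃ (R × Fin q) × (Fin n → Fin q) :=
  ((Equiv.refl R).prodCongr (Fin.insertNthEquiv (fun _ => Fin q) i).symm).trans
    (Equiv.prodAssoc _ _ _).symm

open Classical in
/-- Positions at which two strings agree, if there are any. -/
noncomputable def agreeAt (a b : Fin (n + 1) → Fin N) : Fin (n + 1) × Fin (n + 1) :=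
  -- Without a collision the dummy pair (0, 0) is used: a message is sent all the same, so the
  -- number of messages is exact, and the round is ignored because `hit` vanishes.
  if h : ∃ e : Fin (n + 1) × Fin (n + 1), a e.1 = b e.2 then h.choose else (0, 0)

theorem agreeAt_spec (a b : Fin (n + 1) → Fin N) (h : ∃ i j, a i = b j) :
    a (agreeAt a b).1 = b (agreeAt a b).2 := by
  have h' : ∃ e : Fin (n + 1) × Fin (n + 1), a e.1 = b e.2 := by
    obtain ⟨i, j, hij⟩ := h
    exact ⟨(i, j), hij⟩
  rw [agreeAt, dif_pos h']
  exact h'.choose_spec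

/-- One round: both parties measure `n + 1` copies with the Kraus operators `B`, Alice sends one
of her registers to Bob, and Bob performs a SWAP test with one of his registers; these registers
are in the same block if there is a pair of registers that are. -/
noncomputable def round (B : Fin N → Matrix (Fin q) (Fin d) ℂ) (hB : ∑ t, (B t)ᴴ * B t = 1)
    (next : (Fin (n + 1) → Fin N) → (Fin (n + 1) → Fin N) → Bool →
      Protocol q (CopyBasis d k) (CopyBasis d k)) :
    Protocol q (CopyBasis d (k + (n + 1))) (CopyBasis d (k + (n + 1))) :=
  aliceOn (splitCopies d k (n + 1)) (Equiv.refl _) (tensorKraus B) (sum_tensorKraus B hB) fun a =>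
  bobOn (splitCopies d k (n + 1)) (Equiv.refl _) (tensorKraus B) (sum_tensorKraus B hB) fun b =>
  discardAlice (pickRegister _ q (agreeAt a b).1) <|
  discardBob (pickRegister _ q (agreeAt a b).2) <|
  .sendToBob <| swapTest (next a b)

theorem usesMessages_round (B : Fin N → Matrix (Fin q) (Fin d) ℂ)
    (hB : ∑ t, (B t)ᴴ * B t = 1) (next : (Fin (n + 1) → Fin N) → (Fin (n + 1) → Fin N) → Bool →
      Protocol q (CopyBasis d k) (CopyBasis d k)) (m : ℕ)
    (h : ∀ a b s, (next a b s).UsesMessages m) : (round B hB next).UsesMessages (m + 1) :=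
  usesMessages_aliceOn _ _ _ _ _ _ fun a => usesMessages_bobOn _ _ _ _ _ _ fun b =>
    usesMessages_aliceOn _ _ _ _ _ _ fun _ => usesMessages_bobOn _ _ _ _ _ _ fun _ =>
      ⟨m, rfl, usesMessages_bobOn _ _ _ _ _ _ fun i => h a b i.1⟩

/-- The probability of the block `t`. -/
noncomputable def blockProb (B : Fin N → Matrix (Fin q) (Fin d) ℂ) (ψ : Fin d → ℂ)
    (t : Fin N) : ℝ :=
  ∑ y, ‖(B t *ᵥ ψ) y‖ ^ 2

/-- The inner product of the components of `φ` and `ψ` in the blocks `t` and `t'`. -/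
noncomputable def blockInner (B : Fin N → Matrix (Fin q) (Fin d) ℂ) (ψ φ : Fin d → ℂ)
    (t t' : Fin N) : ℂ :=
  ∑ y, star ((B t *ᵥ ψ) y) * (B t' *ᵥ φ) y

/-- The probability of the outcomes `a`, `b`, `s` of a round. -/
noncomputable def roundWeight (B : Fin N → Matrix (Fin q) (Fin d) ℂ) (ψ φ : Fin d → ℂ)
    (a b : Fin (n + 1) → Fin N) (s : Bool) : ℝ :=
  (∏ i, blockProb B ψ (a ((agreeAt a b).1.succAbove i))) *
    (∏ j, blockProb B φ (b ((agreeAt a b).2.succAbove j))) *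
    ((blockProb B ψ (a (agreeAt a b).1) * blockProb B φ (b (agreeAt a b).2) +
      swapSign s * ‖blockInner B ψ φ (a (agreeAt a b).1) (b (agreeAt a b).2)‖ ^ 2) / 2)

theorem sum_norm_sq_prod (u : Fin n → Fin q → ℂ) :
    ∑ y : Fin n → Fin q, ‖∏ i, u i (y i)‖ ^ 2 = ∏ i, ∑ y, ‖u i y‖ ^ 2 := by
  simp only [norm_prod, ← Finset.prod_pow]
  exact sum_pi_prod fun i y => ‖u i y‖ ^ 2

theorem blockProb_nonneg (B : Fin N → Matrix (Fin q) (Fin d) ℂ) (ψ : Fin d → ℂ) (t : Fin N) :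
    0 ≤ blockProb B ψ t :=
  Finset.sum_nonneg fun _ _ => by positivity

/-- The input stays a product state over parties and copies until the SWAP test. Hence the unused
registers contribute only their norms, and what is left after the test is a multiple of the input
with fewer copies. -/
theorem law_round (B : Fin N → Matrix (Fin q) (Fin d) ℂ) (hB : ∑ t, (B t)ᴴ * B t = 1)
    (next : (Fin (n + 1) → Fin N) → (Fin (n + 1) → Fin N) → Bool →
      Protocol q (CopyBasis d k) (CopyBasis d k)) (ψ φ : EuclideanSpace ℂ (Fin d)) :
    (round B hB next).law (copiesInput (k + (n + 1)) ψ φ) =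
      ∑ a, ∑ b, ∑ s, ENNReal.ofReal (roundWeight B ψ φ a b s) •
        (next a b s).law (copiesInput k ψ φ) := by
  have hsplit : ∀ (χ : EuclideanSpace ℂ (Fin d)) (x : CopyBasis d (k + (n + 1))),
      ∏ i, χ (x i) = (∏ i, χ ((splitCopies d k (n + 1) x).1 i)) *
        ∏ i, χ ((splitCopies d k (n + 1) x).2 i) := by
    intro χ x
    rw [Fin.prod_univ_add]
    rfl
  have hpick : ∀ (u : Fin (n + 1) → Fin q → ℂ) (i : Fin (n + 1))
      (z : CopyBasis d k × (Fin (n + 1) → Fin q)) (f : CopyBasis d k → ℂ),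
      f z.1 * ∏ i, u i (z.2 i) =
        (f (pickRegister _ q i z).1.1 * u i (pickRegister _ q i z).1.2) *
          ∏ i', u (i.succAbove i') ((pickRegister _ q i z).2 i') := by
    intro u i z f
    rw [Fin.prod_univ_succAbove _ i, mul_assoc]
    rfl
  have h0 : copiesInput (k + (n + 1)) ψ φ = fun x y =>
      (∏ i, ψ ((splitCopies d k (n + 1) x).1 i)) * (∏ i, ψ ((splitCopies d k (n + 1) x).2 i)) *
        ∏ i, φ (y i) := by
    funext x y
    rw [copiesInput, hsplit ψ x]
  rw [h0, round, law_aliceOn _ _ _ _ _ (fun x : CopyBasis d k => ∏ i, ψ (x i))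
    (fun x : CopyBasis d (n + 1) => ∏ i, ψ (x i))
    (fun y : CopyBasis d (k + (n + 1)) => ∏ i, φ (y i))]
  refine Finset.sum_congr rfl fun a _ => ?_
  simp only [tensorKraus_mulVec_prod, hsplit φ]
  rw [law_bobOn _ _ _ _ _ (fun x : CopyBasis d k => ∏ i, φ (x i))
    (fun x : CopyBasis d (n + 1) => ∏ i, φ (x i))]
  refine Finset.sum_congr rfl fun b _ => ?_
  simp only [tensorKraus_mulVec_prod, Equiv.refl_apply]
  simp only [hpick (fun i => B (a i) *ᵥ ψ) (agreeAt a b).1 _ (fun x => ∏ i, ψ (x i)),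
    hpick (fun i => B (b i) *ᵥ φ) (agreeAt a b).2 _ (fun x => ∏ i, φ (x i))]
  rw [law_discardAlice _ _
    (fun x : CopyBasis d k × Fin q => (∏ i, ψ (x.1 i)) * (B (a (agreeAt a b).1) *ᵥ ψ) x.2)
    (fun y : Fin n → Fin q => ∏ i', (B (a ((agreeAt a b).1.succAbove i')) *ᵥ ψ) (y i'))]
  rw [law_discardBob _ _
    (fun x : CopyBasis d k × Fin q => (∏ i, φ (x.1 i)) * (B (b (agreeAt a b).2) *ᵥ φ) x.2)
    (fun y : Fin n → Fin q => ∏ i', (B (b ((agreeAt a b).2.succAbove i')) *ᵥ φ) (y i'))]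
  have hsend : ∀ P : Protocol q (CopyBasis d k) ((CopyBasis d k × Fin q) × Fin q),
      (sendToBob P).law (fun x y => (∏ i, ψ (x.1 i)) * (B (a (agreeAt a b).1) *ᵥ ψ) x.2 *
        ((∏ i, φ (y.1 i)) * (B (b (agreeAt a b).2) *ᵥ φ) y.2)) =
      P.law (fun x y => (∏ i, ψ (x i)) * ((∏ i, φ (y.1.1 i)) * (B (b (agreeAt a b).2) *ᵥ φ) y.1.2 *
        (B (a (agreeAt a b).1) *ᵥ ψ) y.2)) := by
    intro P
    simp only [law]
    congr 1
    funext x y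
    ring
  rw [hsend, law_swapTest (next a b) (fun x : CopyBasis d k => ∏ i, ψ (x i))
    (fun x : CopyBasis d k => ∏ i, φ (x i)) (B (b (agreeAt a b).2) *ᵥ φ.ofLp)
    (B (a (agreeAt a b).1) *ᵥ ψ.ofLp)]
  rw [Finset.smul_sum, Finset.smul_sum]
  refine Finset.sum_congr rfl fun s _ => ?_
  rw [smul_smul, smul_smul, sum_norm_sq_prod, sum_norm_sq_prod, ← ENNReal.ofReal_mul,
    ← ENNReal.ofReal_mul]
  · congr 2
    simp only [roundWeight, blockProb, blockInner]
    ring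
  · exact mul_nonneg (Finset.prod_nonneg fun i _ => blockProb_nonneg _ _ _)
      (Finset.prod_nonneg fun i _ => blockProb_nonneg _ _ _)
  · exact Finset.prod_nonneg fun i _ => blockProb_nonneg _ _ _

/-- The factor with the sign is a squared norm by `sum_norm_sq_swap`. -/
theorem roundWeight_nonneg (B : Fin N → Matrix (Fin q) (Fin d) ℂ) (ψ φ : Fin d → ℂ)
    (a b : Fin (n + 1) → Fin N) (s : Bool) : 0 ≤ roundWeight B ψ φ a b s := by
  refine mul_nonneg (mul_nonneg (Finset.prod_nonneg fun i _ => blockProb_nonneg _ _ _)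
    (Finset.prod_nonneg fun i _ => blockProb_nonneg _ _ _)) ?_
  have h := sum_norm_sq_swap (B (b (agreeAt a b).2) *ᵥ φ) (B (a (agreeAt a b).1) *ᵥ ψ) s
  rw [blockInner, blockProb, blockProb, mul_comm (∑ y, ‖(B (a _) *ᵥ ψ) y‖ ^ 2), ← h]
  exact Finset.sum_nonneg fun _ _ => by positivity

/-- Whether the registers used in the SWAP test are in the same block. -/
noncomputable def hit (a b : Fin (n + 1) → Fin N) : ℝ :=
  if a (agreeAt a b).1 = b (agreeAt a b).2 then 1 else 0

variable {U : Type}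

/-- `m` rounds, starting with the partial sums `y` and `t` of the signs and of the numbers of
successful rounds. -/
noncomputable def rounds (n : ℕ) (B : U → Fin N → Matrix (Fin q) (Fin d) ℂ)
    (hB : ∀ u, ∑ t, (B u t)ᴴ * B u t = 1) : (m : ℕ) → (Fin m → U) → ℝ → ℝ →
      Protocol q (CopyBasis d ((n + 1) * m)) (CopyBasis d ((n + 1) * m))
  -- If no round succeeded, division by zero yields the output 0; such runs are controlled by the
  -- deviation bound for the denominator.
  | 0, _, y, t => .output (y / t)
  | m + 1, u, y, t => round (k := (n + 1) * m) (n := n) (B (u 0)) (hB (u 0)) fun a b s =>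
      rounds n B hB m (fun i => u i.succ) (y + swapSign s * hit a b) (t + hit a b)

theorem usesMessages_rounds (B : U → Fin N → Matrix (Fin q) (Fin d) ℂ)
    (hB : ∀ u, ∑ t, (B u t)ᴴ * B u t = 1) (m : ℕ) (u : Fin m → U) (y t : ℝ) :
    (rounds n B hB m u y t).UsesMessages m := by
  induction m generalizing y t with
  | zero => rfl
  | succ m ih => exact usesMessages_round _ _ _ _ fun a b s => ih _ _ _

/-- The outcomes of a round, including the shared randomness. -/
abbrev RoundOutcome (U : Type) (n N : ℕ) : Type :=
  U × (Fin (n + 1) → Fin N) × (Fin (n + 1) → Fin N) × Bool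

variable [Fintype U]

/-- Every round uses fresh copies and its own seed, so the weights multiply. After normalization by
the number of seeds the outcomes are independent and identically distributed. -/
theorem sum_law_rounds (B : U → Fin N → Matrix (Fin q) (Fin d) ℂ)
    (hB : ∀ u, ∑ t, (B u t)ᴴ * B u t = 1) (ψ φ : EuclideanSpace ℂ (Fin d)) (m : ℕ) (y t : ℝ) :
    ∑ u : Fin m → U, (rounds n B hB m u y t).law (copiesInput ((n + 1) * m) ψ φ) =
      ∑ o : Fin m → RoundOutcome U n N,
        ENNReal.ofReal (∏ i, roundWeight (B (o i).1) ψ φ (o i).2.1 (o i).2.2.1 (o i).2.2.2) •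
          MeasureTheory.Measure.dirac
            ((y + ∑ i, swapSign (o i).2.2.2 * hit (o i).2.1 (o i).2.2.1) /
              (t + ∑ i, hit (o i).2.1 (o i).2.2.1)) := by
  induction m generalizing y t with
  | zero => simp [rounds, law, copiesInput]
  | succ m ih =>
    rw [sum_pi_insertNth 0, sum_pi_insertNth 0]
    rw [Fintype.sum_prod_type]
    refine Finset.sum_congr rfl fun u _ => ?_
    have h : ∀ v : Fin m → U, (rounds n B hB (m + 1) (Fin.insertNth 0 u v) y t).law
        (copiesInput ((n + 1) * (m + 1)) ψ φ) =
        ∑ a : Fin (n + 1) → Fin N, ∑ b : Fin (n + 1) → Fin N, ∑ s,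
        ENNReal.ofReal (roundWeight (B u) ψ φ a b s) •
        (rounds n B hB m v (y + swapSign s * hit a b) (t + hit a b)).law
          (copiesInput ((n + 1) * m) ψ φ) := by
      intro v
      exact law_round _ _ _ _ _
    simp only [h]
    rw [Finset.sum_comm, Fintype.sum_prod_type]
    refine Finset.sum_congr rfl fun a _ => ?_
    rw [Finset.sum_comm, Fintype.sum_prod_type]
    refine Finset.sum_congr rfl fun b _ => ?_
    rw [Finset.sum_comm]
    refine Finset.sum_congr rfl fun s _ => ?_
    rw [← Finset.smul_sum, ih, Finset.smul_sum]
    refine Finset.sum_congr rfl fun o _ => ?_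
    rw [smul_smul, ← ENNReal.ofReal_mul (roundWeight_nonneg _ _ _ _ _ _)]
    simp only [Fin.prod_univ_succ, Fin.sum_univ_succ, Fin.insertNth_zero', Fin.cons_zero,
      Fin.cons_succ, add_assoc]

end Batch

end Protocol

/-! ### A random orthonormal basis with controlled second moments -/

section Signs

variable {ι : Type*} [Fintype ι] [DecidableEq ι]

/-- Flipping the sign at z is a bijection of the sign patterns that negates f. -/
theorem sum_signs_eq_zero (f : (ι → ℤˣ) → ℂ) (z : ι)
    (hf : ∀ σ, f (Pi.mulSingle z (-1) * σ) = -f σ) : ∑ σ, f σ = 0 := by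
  have h := Equiv.sum_comp (Equiv.mulLeft (Pi.mulSingle z (-1) : ι → ℤˣ)) f
  simp only [Equiv.coe_mulLeft, hf, Finset.sum_neg_distrib] at h
  have h2 : (2 : ℂ) * ∑ σ, f σ = 0 := by linear_combination -h
  simpa using h2

/-- The product of the signs at the two entries of a pair. -/
def pairSign (σ : ι → ℤˣ) (e : ι × ι) : ℂ := ((σ e.1 : ℤ) : ℂ) * ((σ e.2 : ℤ) : ℂ)

theorem sign_cast_mul_self (s : ℤˣ) : ((s : ℤ) : ℂ) * ((s : ℤ) : ℂ) = 1 := by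
  rcases Int.units_eq_one_or s with h | h <;> simp [h]

/-- Unless the two pairs coincide as sets, some entry of the first is missing from the second, and
flipping the sign there cancels the sum. -/
theorem sum_pairSign_mul (e e' : ι × ι) (he : e.1 ≠ e.2) (he' : e'.1 ≠ e'.2) :
    ∑ σ : ι → ℤˣ, pairSign σ e * pairSign σ e' =
      (Fintype.card (ι → ℤˣ) : ℂ) * ((if e' = e then 1 else 0) + if e' = e.swap then 1 else 0) := by
  obtain ⟨x, y⟩ := e
  obtain ⟨x', y'⟩ := e'
  simp only [pairSign, Prod.swap_prod_mk, Prod.mk.injEq] at *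
  by_cases h1 : x' = x ∧ y' = y
  · obtain ⟨rfl, rfl⟩ := h1
    have h3 : ¬ (x' = y' ∧ y' = x') := fun h => he h.1
    have : ∀ σ : ι → ℤˣ, ((σ x' : ℤ) : ℂ) * ((σ y' : ℤ) : ℂ) *
        (((σ x' : ℤ) : ℂ) * ((σ y' : ℤ) : ℂ)) = 1 := fun σ => by
      linear_combination ((σ y' : ℤ) : ℂ) * ((σ y' : ℤ) : ℂ) * sign_cast_mul_self (σ x') +
        sign_cast_mul_self (σ y')
    simp only [this, h3]
    simp
  by_cases h2 : x' = y ∧ y' = x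
  · obtain ⟨rfl, rfl⟩ := h2
    have : ∀ σ : ι → ℤˣ, ((σ y' : ℤ) : ℂ) * ((σ x' : ℤ) : ℂ) *
        (((σ x' : ℤ) : ℂ) * ((σ y' : ℤ) : ℂ)) = 1 := fun σ => by
      linear_combination ((σ y' : ℤ) : ℂ) * ((σ y' : ℤ) : ℂ) * sign_cast_mul_self (σ x') +
        sign_cast_mul_self (σ y')
    simp only [this, h1]
    simp
  rw [if_neg h1, if_neg h2, add_zero, mul_zero]
  have hz : (x ≠ x' ∧ x ≠ y') ∨ (y ≠ x' ∧ y ≠ y') := by grind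
  rcases hz with ⟨hx, hy⟩ | ⟨hx, hy⟩
  · refine sum_signs_eq_zero _ x fun σ => ?_
    simp [hx.symm, hy.symm, he.symm]
  · refine sum_signs_eq_zero _ y fun σ => ?_
    simp [hx.symm, hy.symm, he]

/-- Second moment of a quadratic form in random signs: the pairs are orthogonal except for the
coincidence of a pair with its swap, and this cross term is absorbed by the inequality of arithmetic
and geometric means, at the cost of the factor 2. -/
theorem sum_signs_norm_sq_le (A : ι × ι → ℂ) :
    ∑ σ : ι → ℤˣ, ‖∑ e ∈ Finset.univ.offDiag, A e * pairSign σ e‖ ^ 2 ≤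
      2 * Fintype.card (ι → ℤˣ) * ∑ e ∈ Finset.univ.offDiag, ‖A e‖ ^ 2 := by
  set D : Finset (ι × ι) := Finset.univ.offDiag
  have hD : ∀ e ∈ D, e.1 ≠ e.2 := fun e he => by simpa [D, Finset.mem_offDiag] using he
  have hswap : ∀ e ∈ D, e.swap ∈ D := fun e he => by
    simpa [D, Finset.mem_offDiag] using (hD e he).symm
  have hreal : ∀ σ : ι → ℤˣ, ∀ e, star (pairSign σ e) = pairSign σ e := by
    intro σ e; simp [pairSign]
  have h1 : ((∑ σ : ι → ℤˣ, ‖∑ e ∈ D, A e * pairSign σ e‖ ^ 2 : ℝ) : ℂ) =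
      Fintype.card (ι → ℤˣ) * ∑ e ∈ D, (A e * star (A e) + A e * star (A e.swap)) := by
    push_cast
    calc _ = ∑ σ : ι → ℤˣ, ∑ e ∈ D, ∑ e' ∈ D,
          A e * star (A e') * (pairSign σ e * pairSign σ e') := by
          refine Finset.sum_congr rfl fun σ _ => ?_
          rw [← Complex.mul_conj', ← Complex.star_def, star_sum, Finset.sum_mul_sum]
          refine Finset.sum_congr rfl fun e _ => Finset.sum_congr rfl fun e' _ => ?_
          rw [star_mul', hreal]
          ring
      _ = ∑ e ∈ D, ∑ e' ∈ D, A e * star (A e') * ∑ σ : ι → ℤˣ, pairSign σ e * pairSign σ e' := by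
          rw [Finset.sum_comm]
          refine Finset.sum_congr rfl fun e _ => ?_
          rw [Finset.sum_comm]
          exact Finset.sum_congr rfl fun e' _ => (Finset.mul_sum _ _ _).symm
      _ = _ := by
          rw [Finset.mul_sum]
          refine Finset.sum_congr rfl fun e he => ?_
          have : ∀ e' ∈ D, A e * star (A e') * ∑ σ : ι → ℤˣ, pairSign σ e * pairSign σ e' =
              (if e' = e then Fintype.card (ι → ℤˣ) * (A e * star (A e')) else 0) +
              if e' = e.swap then Fintype.card (ι → ℤˣ) * (A e * star (A e')) else 0 := by
            intro e' he'
            rw [sum_pairSign_mul e e' (hD e he) (hD e' he')]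
            split_ifs <;> ring
          rw [Finset.sum_congr rfl this, Finset.sum_add_distrib, Finset.sum_ite_eq',
            Finset.sum_ite_eq', if_pos he, if_pos (hswap e he)]
          ring
  have h2 : ∑ e ∈ D, ‖A e.swap‖ ^ 2 = ∑ e ∈ D, ‖A e‖ ^ 2 :=
    Finset.sum_bij' (fun e _ => e.swap) (fun e _ => e.swap) hswap hswap (by simp) (by simp)
      (by simp)
  have h3 : ‖∑ e ∈ D, (A e * star (A e) + A e * star (A e.swap))‖ ≤ 2 * ∑ e ∈ D, ‖A e‖ ^ 2 := by
    calc _ ≤ ∑ e ∈ D, (‖A e‖ ^ 2 + (‖A e‖ ^ 2 + ‖A e.swap‖ ^ 2) / 2) := by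
          refine (norm_sum_le _ _).trans (Finset.sum_le_sum fun e _ => (norm_add_le _ _).trans ?_)
          simp only [norm_mul, norm_star]
          nlinarith [sq_nonneg (‖A e‖ - ‖A e.swap‖)]
      _ = _ := by
          rw [Finset.sum_add_distrib, ← Finset.sum_div, Finset.sum_add_distrib, h2]
          ring
  have h4 := congrArg norm h1
  rw [Complex.norm_real, Real.norm_of_nonneg (Finset.sum_nonneg fun _ _ => by positivity),
    norm_mul, Complex.norm_natCast] at h4
  rw [h4, mul_comm (2 : ℝ), mul_assoc]
  gcongr

/-- The symmetric group is doubly transitive, so the sum over permutations is the same for every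
off-diagonal pair; summing over these pairs first, each permutation merely rearranges them. -/
theorem sum_perm_offDiag (g : ι → ι → ℝ) {x y : ι} (hxy : x ≠ y) :
    ((Finset.univ : Finset ι).offDiag.card : ℝ) * ∑ π : Equiv.Perm ι, g (π x) (π y) =
      Fintype.card (Equiv.Perm ι) * ∑ e ∈ (Finset.univ : Finset ι).offDiag, g e.1 e.2 := by
  have h1 : ∀ e ∈ (Finset.univ : Finset ι).offDiag,
      ∑ π : Equiv.Perm ι, g (π e.1) (π e.2) = ∑ π : Equiv.Perm ι, g (π x) (π y) := by
    rintro ⟨x', y'⟩ he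
    have hne : x' ≠ y' := by simpa [Finset.mem_offDiag] using he
    obtain ⟨τ, hτx, hτy⟩ : ∃ τ : Equiv.Perm ι, τ x = x' ∧ τ y = y' := by
      -- Move x to x', then the image of y to y'. The second swap fixes x', since both of its
      -- entries differ from x'.
      refine ⟨Equiv.swap (Equiv.swap x x' y) y' * Equiv.swap x x', ?_, ?_⟩
      · rw [Equiv.Perm.mul_apply, Equiv.swap_apply_left]
        refine Equiv.swap_apply_of_ne_of_ne ?_ hne
        intro h
        rw [← Equiv.swap_apply_left x x'] at h
        exact hxy ((Equiv.swap x x').injective (by simpa using h))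
      · rw [Equiv.Perm.mul_apply, Equiv.swap_apply_left]
    have h := Equiv.sum_comp (Equiv.mulRight τ) fun π : Equiv.Perm ι => g (π x) (π y)
    simp only [Equiv.coe_mulRight, Equiv.Perm.mul_apply, hτx, hτy] at h
    exact h
  rw [← nsmul_eq_mul, ← Finset.sum_const, ← Finset.sum_congr rfl h1, Finset.sum_comm]
  have h2 : ∀ π : Equiv.Perm ι, ∑ e ∈ (Finset.univ : Finset ι).offDiag, g (π e.1) (π e.2) =
      ∑ e ∈ (Finset.univ : Finset ι).offDiag, g e.1 e.2 := by
    intro π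
    exact Finset.sum_equiv (π.prodCongr π) (by simp [Finset.mem_offDiag]) (by simp)
  simp only [h2, Finset.sum_const, nsmul_eq_mul, Finset.card_univ]

end Signs

/-! ### A unitary matrix with entries of constant modulus -/

section Fourier

variable (d : ℕ) [NeZero d]

/-- The matrix of the discrete Fourier transform. -/
noncomputable def fourierMatrix : Matrix (Fin d) (Fin d) ℂ :=
  fun j x => Complex.exp (2 * Real.pi * Complex.I / d) ^ (j.val * x.val) / (Real.sqrt d : ℂ)

theorem norm_fourierMatrix_sq (j x : Fin d) : ‖fourierMatrix d j x‖ ^ 2 = 1 / d := by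
  have h : ‖Complex.exp (2 * Real.pi * Complex.I / d)‖ = 1 :=
    (Complex.isPrimitiveRoot_exp d (NeZero.ne d)).norm'_eq_one (NeZero.ne d)
  rw [fourierMatrix, norm_div, norm_pow, h, one_pow, div_pow, Complex.norm_real, Real.norm_eq_abs,
    sq_abs, Real.sq_sqrt (Nat.cast_nonneg d), one_pow]

theorem fourierMatrix_conjTranspose_mul : (fourierMatrix d)ᴴ * fourierMatrix d = 1 := by
  set ζ := Complex.exp (2 * Real.pi * Complex.I / d)
  have hζ : IsPrimitiveRoot ζ d := Complex.isPrimitiveRoot_exp d (NeZero.ne d)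
  have hn : ‖ζ‖ = 1 := hζ.norm'_eq_one (NeZero.ne d)
  have hζ0 : ζ ≠ 0 := hζ.ne_zero (NeZero.ne d)
  have hd : (d : ℂ) ≠ 0 := Nat.cast_ne_zero.mpr (NeZero.ne d)
  have hs : (Real.sqrt d : ℂ) * (Real.sqrt d : ℂ) = d := by
    rw [← Complex.ofReal_mul, Real.mul_self_sqrt (Nat.cast_nonneg d), Complex.ofReal_natCast]
  have hstar : star ζ = ζ⁻¹ := (Complex.inv_eq_conj hn).symm
  ext x y
  rw [Matrix.mul_apply]
  have hterm : ∀ j : Fin d, (fourierMatrix d)ᴴ x j * fourierMatrix d j y =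
      ((ζ⁻¹ ^ x.val * ζ ^ y.val) ^ j.val) / d := by
    intro j
    rw [Matrix.conjTranspose_apply, fourierMatrix, star_div₀, star_pow]
    change star ζ ^ _ / _ * (ζ ^ _ / _) = _
    rw [hstar, Complex.star_def, Complex.conj_ofReal, div_mul_div_comm, hs, mul_pow, ← pow_mul,
      ← pow_mul, mul_comm x.val, mul_comm y.val]
  simp only [hterm]
  rw [← Finset.sum_div, Fin.sum_univ_eq_sum_range fun j => (ζ⁻¹ ^ x.val * ζ ^ y.val) ^ j]
  by_cases hxy : x = y
  · subst hxy
    rw [inv_pow, inv_mul_cancel₀ (pow_ne_zero _ hζ0)]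
    simp [hd]
  · rw [Matrix.one_apply_ne hxy]
    have hne : ζ⁻¹ ^ x.val * ζ ^ y.val ≠ 1 := by
      rw [inv_pow]
      intro h
      have h' : ζ ^ y.val = ζ ^ x.val := by
        rw [inv_mul_eq_iff_eq_mul₀ (pow_ne_zero _ hζ0), mul_one] at h
        exact h
      exact hxy (Fin.ext (hζ.pow_inj x.isLt y.isLt h'.symm))
    have hpow : (ζ⁻¹ ^ x.val * ζ ^ y.val) ^ d = 1 := by
      rw [mul_pow, ← pow_mul, ← pow_mul, mul_comm _ d, mul_comm _ d, pow_mul, pow_mul, inv_pow,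
        hζ.pow_eq_one]
      simp
    rw [geom_sum_eq hne, hpow, sub_self, zero_div, zero_div]

theorem fourierMatrix_mul_conjTranspose : fourierMatrix d * (fourierMatrix d)ᴴ = 1 :=
  mul_eq_one_comm.mp (fourierMatrix_conjTranspose_mul d)

end Fourier

/-! ### Blocks of the randomized Fourier basis and their second moments -/

section Blocks

open Protocol

variable (d q : ℕ)

/-- The rows `q * t, …, q * t + q - 1` of the Fourier matrix, as far as they exist. -/
noncomputable def fourierBlock (t : Fin (d / q + 1)) : Matrix (Fin q) (Fin d) ℂ :=
  fun z x => if h : z.val + q * t.val < d then fourierMatrix d ⟨z.val + q * t.val, h⟩ x else 0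

/-- The number of rows of a block. -/
noncomputable def blockSize (t : Fin (d / q + 1)) : ℝ :=
  ∑ z : Fin q, if z.val + q * t.val < d then 1 else 0

theorem blockSize_nonneg (t : Fin (d / q + 1)) : 0 ≤ blockSize d q t :=
  Finset.sum_nonneg fun _ _ => by split_ifs <;> norm_num

theorem blockSize_le (t : Fin (d / q + 1)) : blockSize d q t ≤ q := by
  calc blockSize d q t ≤ ∑ _z : Fin q, (1 : ℝ) :=
        Finset.sum_le_sum fun _ _ => by split_ifs <;> norm_num
    _ = q := by simp

theorem blockSize_eq (t : Fin (d / q + 1)) (ht : t.val < d / q) : blockSize d q t = q := by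
  have h : ∀ z : Fin q, z.val + q * t.val < d := by
    intro z
    have h1 : q * (t.val + 1) ≤ q * (d / q) := Nat.mul_le_mul_left q ht
    have h2 := Nat.mul_div_le d q
    have h3 := z.isLt
    rw [mul_add, mul_one] at h1
    omega
  simp [blockSize, h]

variable [NeZero d]

/-- The Gram matrix of the columns of a block. -/
noncomputable def blockGram (t : Fin (d / q + 1)) (x y : Fin d) : ℂ :=
  ∑ z, star (fourierBlock d q t z x) * fourierBlock d q t z y

/-- This is why the Fourier basis is used: entries of constant modulus make the diagonal constant,
so the diagonal part of a block inner product is an exact multiple of ⟨ψ, φ⟩. -/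
theorem blockGram_self (t : Fin (d / q + 1)) (x : Fin d) :
    blockGram d q t x x = ((blockSize d q t / d : ℝ) : ℂ) := by
  rw [blockGram, blockSize, Finset.sum_div, Complex.ofReal_sum]
  refine Finset.sum_congr rfl fun z _ => ?_
  rw [Complex.star_def, Complex.conj_mul', fourierBlock]
  split_ifs with h
  · rw [← Complex.ofReal_pow, norm_fourierMatrix_sq]
  · simp

theorem fourierBlock_inner (t : Fin (d / q + 1)) (z z' : Fin q) :
    ∑ x, fourierBlock d q t z x * star (fourierBlock d q t z' x) =
      if z = z' then (if z.val + q * t.val < d then 1 else 0) else 0 := by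
  by_cases h : z.val + q * t.val < d
  · by_cases h' : z'.val + q * t.val < d
    · have := congrFun (congrFun (fourierMatrix_mul_conjTranspose d) ⟨_, h⟩) ⟨_, h'⟩
      simp only [Matrix.mul_apply, Matrix.conjTranspose_apply] at this
      simp only [fourierBlock, h, h', dif_pos, this, Matrix.one_apply, Fin.mk.injEq,
        add_left_inj, Fin.val_inj, if_true]
    · have : z ≠ z' := by rintro rfl; exact h' h
      simp [fourierBlock, h', this]
  · simp [fourierBlock, h]

/-- The Gram matrix is the orthogonal projection onto the span of the conjugated rows, and the
squared Frobenius norm of a projection is its rank. -/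
theorem sum_norm_blockGram_sq (t : Fin (d / q + 1)) :
    ∑ x, ∑ y, ‖blockGram d q t x y‖ ^ 2 = blockSize d q t := by
  have h : ((∑ x, ∑ y, ‖blockGram d q t x y‖ ^ 2 : ℝ) : ℂ) = (blockSize d q t : ℂ) := by
    push_cast
    calc _ = ∑ z, ∑ z', (∑ x, fourierBlock d q t z' x * star (fourierBlock d q t z x)) *
          ∑ y, fourierBlock d q t z y * star (fourierBlock d q t z' y) := by
          simp only [← Complex.mul_conj', ← Complex.star_def, blockGram, star_sum, star_mul',
            star_star, Finset.sum_mul_sum]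
          simp only [Finset.sum_comm (s := (Finset.univ : Finset (Fin d)))
            (t := (Finset.univ : Finset (Fin q)))]
          refine Finset.sum_congr rfl fun z _ => Finset.sum_congr rfl fun z' _ =>
            Finset.sum_congr rfl fun x _ => Finset.sum_congr rfl fun y _ => ?_
          ring
      _ = _ := by
          simp only [fourierBlock_inner, blockSize]
          push_cast
          refine Finset.sum_congr rfl fun z _ => ?_
          rw [Finset.sum_eq_single z (by intro z' _ h; simp [h]) (by simp)]
          by_cases h : z.val + q * t.val < d <;> simp [h]
  exact_mod_cast h

/-- The shared randomness of a round. -/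
abbrev BasisSeed : Type := (Fin d → ℤˣ) × Equiv.Perm (Fin d)

/-- The Kraus operators of the measurement of a random block. -/
noncomputable def randomBlock (u : BasisSeed d) (t : Fin (d / q + 1)) :
    Matrix (Fin q) (Fin d) ℂ :=
  fun z x => fourierBlock d q t z (u.2 x) * ((u.1 x : ℤ) : ℂ)

/-- The blocks tile the rows of a unitary matrix. The extra block holds the remainder of d modulo q,
padded with zero rows, and is entirely zero if q divides d. -/
theorem sum_fourierBlock (hq : 0 < q) (x y : Fin d) :
    ∑ t, ∑ z, star (fourierBlock d q t z x) * fourierBlock d q t z y = if x = y then 1 else 0 := by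
  let g : ℕ → ℂ := fun j => if h : j < d then
    star (fourierMatrix d ⟨j, h⟩ x) * fourierMatrix d ⟨j, h⟩ y else 0
  have h1 : ∀ t z, star (fourierBlock d q t z x) * fourierBlock d q t z y =
      g (z.val + q * t.val) := by
    intro t z
    by_cases h : z.val + q * t.val < d <;> simp [fourierBlock, g, h]
  have hle : d ≤ (d / q + 1) * q := by
    have := Nat.lt_div_mul_add (a := d) hq
    rw [add_mul, one_mul]; omega
  simp only [h1]
  rw [← Fintype.sum_prod_type' (f := fun (t : Fin (d / q + 1)) (z : Fin q) =>
    g (z.val + q * t.val))]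
  calc _ = ∑ i : Fin ((d / q + 1) * q), g i.val :=
        Fintype.sum_equiv finProdFinEquiv _ _ fun i => by simp
    _ = ∑ j ∈ Finset.range d, g j := by
        rw [Fin.sum_univ_eq_sum_range]
        refine (Finset.sum_subset (Finset.range_mono hle) fun j _ hj => ?_).symm
        simp only [Finset.mem_range] at hj
        simp [g, hj]
    _ = ∑ j : Fin d, star (fourierMatrix d j x) * fourierMatrix d j y := by
        rw [← Fin.sum_univ_eq_sum_range]
        simp [g]
    _ = _ := by
        have := congrFun (congrFun (fourierMatrix_conjTranspose_mul d) x) y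
        simpa only [Matrix.mul_apply, Matrix.conjTranspose_apply, Matrix.one_apply] using this

theorem sum_randomBlock (hq : 0 < q) (u : BasisSeed d) :
    ∑ t, (randomBlock d q u t)ᴴ * randomBlock d q u t = 1 := by
  ext x y
  simp only [Matrix.sum_apply, Matrix.mul_apply, Matrix.conjTranspose_apply, randomBlock]
  have h : ∀ t z, star (fourierBlock d q t z (u.2 x) * ((u.1 x : ℤ) : ℂ)) *
      (fourierBlock d q t z (u.2 y) * ((u.1 y : ℤ) : ℂ)) =
      star (fourierBlock d q t z (u.2 x)) * fourierBlock d q t z (u.2 y) *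
        (((u.1 x : ℤ) : ℂ) * ((u.1 y : ℤ) : ℂ)) := by
    intro t z
    simp only [star_mul', star_intCast]
    ring
  simp only [h, ← Finset.sum_mul, sum_fourierBlock d q hq, Matrix.one_apply, u.2.injective.eq_iff]
  split_ifs with hxy
  · subst hxy; rw [sign_cast_mul_self, one_mul]
  · rw [zero_mul]

/-- On the diagonal the signs square to 1 and `blockGram_self` applies, so the deviation is a purely
off-diagonal quadratic form in the random signs. -/
theorem blockInner_sub_eq (u : BasisSeed d) (t : Fin (d / q + 1)) (ψ φ : Fin d → ℂ) :
    blockInner (randomBlock d q u) ψ φ t t -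
      ((blockSize d q t / d : ℝ) : ℂ) * ∑ x, star (ψ x) * φ x =
      ∑ e ∈ Finset.univ.offDiag, star (ψ e.1) * φ e.2 * blockGram d q t (u.2 e.1) (u.2 e.2) *
        pairSign u.1 e := by
  have h1 : blockInner (randomBlock d q u) ψ φ t t =
      ∑ x, ∑ y, star (ψ x) * φ y * blockGram d q t (u.2 x) (u.2 y) *
        (((u.1 x : ℤ) : ℂ) * ((u.1 y : ℤ) : ℂ)) := by
    simp only [blockInner, Matrix.mulVec, dotProduct, randomBlock, star_sum, star_mul',
      star_intCast, Finset.sum_mul_sum, blockGram]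
    simp only [Finset.mul_sum, Finset.sum_mul]
    rw [Finset.sum_comm]
    refine Finset.sum_congr rfl fun x _ => ?_
    rw [Finset.sum_comm]
    exact Finset.sum_congr rfl fun y _ => Finset.sum_congr rfl fun z _ => by ring
  rw [h1, ← Fintype.sum_prod_type', ← Finset.univ_product_univ, ← Finset.diag_union_offDiag,
    Finset.sum_union (Finset.disjoint_diag_offDiag _), Finset.sum_diag]
  have h2 : ∀ x, star (ψ x) * φ x * blockGram d q t (u.2 x) (u.2 x) *
      (((u.1 x : ℤ) : ℂ) * ((u.1 x : ℤ) : ℂ)) =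
      ((blockSize d q t / d : ℝ) : ℂ) * (star (ψ x) * φ x) := by
    intro x
    rw [sign_cast_mul_self, blockGram_self]; ring
  simp only [h2, ← Finset.mul_sum]
  rw [add_sub_cancel_left]
  rfl

/-- The signs reduce the second moment to twice a weighted sum of squared off-diagonal Gram entries.
The permutation replaces each of these by their average, at most q/(d(d-1)), and the weights |ψ x|²
|φ y|² sum to at most 1. For d = 1 both sides are 0. -/
theorem sum_norm_blockInner_sub_sq_le (t : Fin (d / q + 1)) (ψ φ : Fin d → ℂ)
    (hψ : ∑ x, ‖ψ x‖ ^ 2 = 1) (hφ : ∑ x, ‖φ x‖ ^ 2 = 1) :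
    ∑ u : BasisSeed d, ‖blockInner (randomBlock d q u) ψ φ t t -
      ((blockSize d q t / d : ℝ) : ℂ) * ∑ x, star (ψ x) * φ x‖ ^ 2 ≤
      Fintype.card (BasisSeed d) * (2 * q / (d * (d - 1))) := by
  simp only [blockInner_sub_eq]
  rw [Fintype.sum_prod_type_right]
  have hsum : ∑ e ∈ (Finset.univ : Finset (Fin d)).offDiag, ‖blockGram d q t e.1 e.2‖ ^ 2 ≤ q := by
    refine le_trans ?_ (blockSize_le d q t)
    rw [← sum_norm_blockGram_sq, ← Fintype.sum_prod_type']
    exact Finset.sum_le_sum_of_subset_of_nonneg (Finset.subset_univ _) fun _ _ _ => by positivity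
  have hdd : (((Finset.univ : Finset (Fin d)).offDiag.card : ℕ) : ℝ) = d * (d - 1) := by
    rw [Finset.offDiag_card, Finset.card_univ, Fintype.card_fin, Nat.cast_sub (Nat.le_mul_self d)]
    push_cast; ring
  have hperm : ∀ e ∈ (Finset.univ : Finset (Fin d)).offDiag,
      ∑ π : Equiv.Perm (Fin d), ‖blockGram d q t (π e.1) (π e.2)‖ ^ 2 ≤
        Fintype.card (Equiv.Perm (Fin d)) * (q / (d * (d - 1))) := by
    intro e he
    have hne : e.1 ≠ e.2 := by simpa [Finset.mem_offDiag] using he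
    have h := sum_perm_offDiag (fun x y => ‖blockGram d q t x y‖ ^ 2) hne
    have hpos : (0 : ℝ) < d * (d - 1) := by
      rw [← hdd]; exact_mod_cast Finset.card_pos.mpr ⟨e, he⟩
    rw [hdd] at h
    rw [mul_div_assoc', le_div_iff₀ hpos, mul_comm, h]
    gcongr
  calc _ ≤ ∑ π : Equiv.Perm (Fin d), 2 * Fintype.card (Fin d → ℤˣ) *
        ∑ e ∈ Finset.univ.offDiag, ‖star (ψ e.1) * φ e.2 * blockGram d q t (π e.1) (π e.2)‖ ^ 2 :=
        Finset.sum_le_sum fun π _ => sum_signs_norm_sq_le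
          fun e => star (ψ e.1) * φ e.2 * blockGram d q t (π e.1) (π e.2)
    _ = 2 * Fintype.card (Fin d → ℤˣ) * ∑ e ∈ Finset.univ.offDiag,
        ‖ψ e.1‖ ^ 2 * ‖φ e.2‖ ^ 2 * ∑ π : Equiv.Perm (Fin d),
          ‖blockGram d q t (π e.1) (π e.2)‖ ^ 2 := by
        rw [← Finset.mul_sum, Finset.sum_comm]
        simp only [norm_mul, norm_star, mul_pow, Finset.mul_sum]
    _ ≤ 2 * Fintype.card (Fin d → ℤˣ) * ∑ e ∈ Finset.univ.offDiag,
        ‖ψ e.1‖ ^ 2 * ‖φ e.2‖ ^ 2 *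
          (Fintype.card (Equiv.Perm (Fin d)) * (q / (d * (d - 1)))) := by
        gcongr with e he
        exact hperm e he
    _ = 2 * Fintype.card (Fin d → ℤˣ) * (Fintype.card (Equiv.Perm (Fin d)) * (q / (d * (d - 1)))) *
        ∑ e ∈ (Finset.univ : Finset (Fin d)).offDiag, ‖ψ e.1‖ ^ 2 * ‖φ e.2‖ ^ 2 := by
        rw [← Finset.sum_mul]; ring
    _ ≤ 2 * Fintype.card (Fin d → ℤˣ) *
        (Fintype.card (Equiv.Perm (Fin d)) * (q / (d * (d - 1)))) * 1 := by
        have hd1 : (0 : ℝ) ≤ d - 1 := by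
          rw [sub_nonneg]; exact_mod_cast NeZero.one_le
        gcongr
        calc _ ≤ ∑ e : Fin d × Fin d, ‖ψ e.1‖ ^ 2 * ‖φ e.2‖ ^ 2 :=
              Finset.sum_le_sum_of_subset_of_nonneg (Finset.subset_univ _)
                fun _ _ _ => by positivity
          _ = 1 := by
              rw [Fintype.sum_prod_type]
              dsimp only
              rw [← Finset.sum_mul_sum, hψ, hφ, one_mul]
    _ = _ := by
        rw [Fintype.card_prod]; push_cast; ring

end Blocks

/-! ### Hits and bias in a round with a fixed basis -/

namespace Protocol

section RoundStatistics

variable {q d N n : ℕ}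

theorem sum_blockProb (B : Fin N → Matrix (Fin q) (Fin d) ℂ) (hB : ∑ t, (B t)ᴴ * B t = 1)
    (ψ : Fin d → ℂ) (hψ : ∑ x, ‖ψ x‖ ^ 2 = 1) : ∑ t, blockProb B ψ t = 1 := by
  have h1 : ∀ v : Fin q → ℂ, ((∑ y, ‖v y‖ ^ 2 : ℝ) : ℂ) = star v ⬝ᵥ v := by
    intro v
    push_cast
    exact Finset.sum_congr rfl fun y _ => (Complex.conj_mul' _).symm
  have h2 : ((∑ t, blockProb B ψ t : ℝ) : ℂ) = star ψ ⬝ᵥ ((∑ t, (B t)ᴴ * B t) *ᵥ ψ) := by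
    rw [Matrix.sum_mulVec, dotProduct_sum, Complex.ofReal_sum]
    refine Finset.sum_congr rfl fun t _ => ?_
    rw [blockProb, h1, Matrix.star_mulVec, Matrix.dotProduct_mulVec, Matrix.vecMul_vecMul,
      ← Matrix.dotProduct_mulVec]
  have h3 : star ψ ⬝ᵥ ψ = 1 := by
    have h := Finset.sum_congr rfl fun x (_ : x ∈ Finset.univ) => Complex.conj_mul' (ψ x)
    refine Eq.trans h ?_
    exact_mod_cast hψ
  rw [hB, Matrix.one_mulVec, h3] at h2
  exact_mod_cast h2

theorem blockInner_self (B : Fin N → Matrix (Fin q) (Fin d) ℂ) (ψ : Fin d → ℂ) (t : Fin N) :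
    blockInner B ψ ψ t t = (blockProb B ψ t : ℂ) := by
  rw [blockInner, blockProb]
  push_cast
  exact Finset.sum_congr rfl fun y _ => Complex.conj_mul' _

theorem hit_eq (a b : Fin (n + 1) → Fin N) : hit a b = if ∃ i j, a i = b j then 1 else 0 := by
  rw [hit]
  by_cases h : ∃ i j, a i = b j
  · rw [if_pos h, if_pos (agreeAt_spec a b h)]
  · rw [if_neg h, if_neg fun h' => h ⟨_, _, h'⟩]

/-- Forgetting the result of the SWAP test leaves the law of independent block measurements; the
choice of the tested registers does not affect it. -/
theorem sum_roundWeight (B : Fin N → Matrix (Fin q) (Fin d) ℂ) (ψ φ : Fin d → ℂ)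
    (a b : Fin (n + 1) → Fin N) :
    ∑ s, roundWeight B ψ φ a b s = (∏ i, blockProb B ψ (a i)) * ∏ j, blockProb B φ (b j) := by
  rw [Fin.prod_univ_succAbove _ (agreeAt a b).1,
    Fin.prod_univ_succAbove (fun j => blockProb B φ (b j)) (agreeAt a b).2]
  simp only [Fintype.sum_bool, roundWeight, swapSign, if_true, Bool.false_eq_true, if_false]
  ring

/-- The tested pair depends on the whole strings. Replacing it by the sum over all agreeing pairs
removes this dependence, and the absolute value inside makes every added term nonnegative. -/
theorem sum_roundWeight_mul_error (B : Fin N → Matrix (Fin q) (Fin d) ℂ) (ψ φ : Fin d → ℂ)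
    (F : ℝ) (a b : Fin (n + 1) → Fin N) :
    |∑ s, roundWeight B ψ φ a b s * (swapSign s * hit a b - F * hit a b)| ≤
      ∑ i, ∑ j, if a i = b j then (∏ i', blockProb B ψ (a (i.succAbove i'))) *
        (∏ j', blockProb B φ (b (j.succAbove j'))) *
        |‖blockInner B ψ φ (a i) (a i)‖ ^ 2 - F * (blockProb B ψ (a i) * blockProb B φ (a i))|
        else 0 := by
  set i := (agreeAt a b).1 with hi
  set j := (agreeAt a b).2 with hj
  have hnn : ∀ i j, 0 ≤ if a i = b j then (∏ i', blockProb B ψ (a (i.succAbove i'))) *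
      (∏ j', blockProb B φ (b (j.succAbove j'))) *
      |‖blockInner B ψ φ (a i) (a i)‖ ^ 2 - F * (blockProb B ψ (a i) * blockProb B φ (a i))|
      else 0 := by
    intro i j
    split_ifs
    · exact mul_nonneg (mul_nonneg (Finset.prod_nonneg fun _ _ => blockProb_nonneg _ _ _)
        (Finset.prod_nonneg fun _ _ => blockProb_nonneg _ _ _)) (abs_nonneg _)
    · exact le_rfl
  by_cases h : a i = b j
  · have hle := (Finset.single_le_sum (fun j _ => hnn i j) (Finset.mem_univ j)).trans
      (Finset.single_le_sum (f := fun i => ∑ j, if a i = b j then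
        (∏ i', blockProb B ψ (a (i.succAbove i'))) *
        (∏ j', blockProb B φ (b (j.succAbove j'))) *
        |‖blockInner B ψ φ (a i) (a i)‖ ^ 2 - F * (blockProb B ψ (a i) * blockProb B φ (a i))|
        else 0) (fun i _ => Finset.sum_nonneg fun j _ => hnn i j) (Finset.mem_univ i))
    refine le_trans (le_of_eq ?_) hle
    have hw : 0 ≤ (∏ i', blockProb B ψ (a (i.succAbove i'))) *
        (∏ j', blockProb B φ (b (j.succAbove j'))) :=
      mul_nonneg (Finset.prod_nonneg fun _ _ => blockProb_nonneg _ _ _)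
        (Finset.prod_nonneg fun _ _ => blockProb_nonneg _ _ _)
    rw [if_pos h]
    nth_rw 1 [← abs_of_nonneg hw]
    rw [← abs_mul]
    congr 1
    have hhit : hit a b = 1 := by rw [hit, if_pos h]
    simp only [Fintype.sum_bool, roundWeight, swapSign, if_true, Bool.false_eq_true, if_false,
      hhit, ← hi, ← hj, ← h]
    ring
  · have hhit : hit a b = 0 := by rw [hit, if_neg h]
    simp only [hhit, mul_zero, sub_zero, Finset.sum_const_zero, abs_zero]
    exact Finset.sum_nonneg fun i _ => Finset.sum_nonneg fun j _ => hnn i j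

/-- For each of the (n + 1)² fixed pairs of positions, `sum_agree_eq` sums out all other positions.
-/
theorem abs_sum_round_error_le (B : Fin N → Matrix (Fin q) (Fin d) ℂ)
    (hB : ∑ t, (B t)ᴴ * B t = 1) (ψ φ : Fin d → ℂ) (hψ : ∑ x, ‖ψ x‖ ^ 2 = 1)
    (hφ : ∑ x, ‖φ x‖ ^ 2 = 1) (F : ℝ) :
    |∑ a : Fin (n + 1) → Fin N, ∑ b : Fin (n + 1) → Fin N, ∑ s,
      roundWeight B ψ φ a b s * (swapSign s * hit a b - F * hit a b)| ≤
      (n + 1) ^ 2 * ∑ t, |‖blockInner B ψ φ t t‖ ^ 2 - F * (blockProb B ψ t * blockProb B φ t)| := by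
  refine (Finset.abs_sum_le_sum_abs _ _).trans ((Finset.sum_le_sum fun a _ =>
    (Finset.abs_sum_le_sum_abs _ _).trans (Finset.sum_le_sum fun b _ =>
      sum_roundWeight_mul_error B ψ φ F a b)).trans (le_of_eq ?_))
  have h : ∀ i j : Fin (n + 1), _ := fun i j => sum_agree_eq (blockProb B ψ) (blockProb B φ)
    (fun t => |‖blockInner B ψ φ t t‖ ^ 2 - F * (blockProb B ψ t * blockProb B φ t)|)
    (sum_blockProb B hB ψ hψ) (sum_blockProb B hB φ hφ) i j
  calc _ = ∑ i : Fin (n + 1), ∑ j : Fin (n + 1),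
        ∑ t, |‖blockInner B ψ φ t t‖ ^ 2 - F * (blockProb B ψ t * blockProb B φ t)| := by
        simp only [Finset.sum_comm (s := (Finset.univ : Finset (Fin (n + 1) → Fin N)))
          (t := (Finset.univ : Finset (Fin (n + 1))))]
        exact Finset.sum_congr rfl fun i _ => Finset.sum_congr rfl fun j _ => h i j
    _ = _ := by simp; ring

end RoundStatistics

end Protocol

/-! ### Averages over the random basis -/

/-- If z ≈ l g and p, r ≈ l, then both |z|² and |g|² p r are close to l² |g|². The errors linear in
a deviation x are split as 2ρx ≤ eρ² + x²/e, so that second moments suffice on averaging. -/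
theorem abs_norm_sq_sub_mul_le (z g : ℂ) (p r l ρ e : ℝ) (hl : 0 ≤ l) (hlρ : l ≤ ρ) (he : 0 < e)
    (he1 : e ≤ 1) (hg : ‖g‖ ≤ 1) :
    |‖z‖ ^ 2 - ‖g‖ ^ 2 * (p * r)| ≤
      2 / e * ‖z - l * g‖ ^ 2 + 1 / e * ((p - l) ^ 2 + (r - l) ^ 2) + 2 * e * ρ ^ 2 := by
  have amgm : ∀ x : ℝ, 2 * ρ * x ≤ e * ρ ^ 2 + 1 / e * x ^ 2 := by
    intro x
    have : e * ρ ^ 2 + 1 / e * x ^ 2 - 2 * ρ * x = (e * ρ - x) ^ 2 / e := by field_simp; ring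
    have : 0 ≤ (e * ρ - x) ^ 2 / e := by positivity
    linarith
  have he2 : 1 ≤ 1 / e := by rw [le_div_iff₀ he]; linarith
  have hρ : 0 ≤ ρ := hl.trans hlρ
  have h1 : |‖z‖ ^ 2 - (l * ‖g‖) ^ 2| ≤ ‖z - l * g‖ ^ 2 + 2 * ρ * ‖z - l * g‖ := by
    have hn : ‖(l : ℂ) * g‖ = l * ‖g‖ := by rw [norm_mul, Complex.norm_real, Real.norm_of_nonneg hl]
    have h2 := abs_norm_sub_norm_le z (l * g)
    rw [hn] at h2
    set x := ‖z - l * g‖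
    set v := l * ‖g‖
    have hv : v ≤ ρ := by nlinarith [norm_nonneg g]
    have hv0 : 0 ≤ v := mul_nonneg hl (norm_nonneg g)
    have hx : 0 ≤ x := norm_nonneg _
    have hz : 0 ≤ ‖z‖ := norm_nonneg z
    rw [sq_sub_sq, abs_mul, abs_of_nonneg (by positivity)]
    have h3 : ‖z‖ + v ≤ x + 2 * ρ := by linarith [le_of_abs_le h2]
    nlinarith [abs_nonneg (‖z‖ - v)]
  have h2 : |p * r - l ^ 2| ≤ ((p - l) ^ 2 + (r - l) ^ 2) / 2 + ρ * |p - l| + ρ * |r - l| := by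
    have : p * r - l ^ 2 = (p - l) * (r - l) + l * (p - l) + l * (r - l) := by ring
    rw [this]
    refine (abs_add_le _ _).trans (add_le_add ((abs_add_le _ _).trans (add_le_add ?_ ?_)) ?_)
    · rw [abs_mul]
      nlinarith [sq_nonneg (|p - l| - |r - l|), sq_abs (p - l), sq_abs (r - l)]
    · rw [abs_mul, abs_of_nonneg hl]; gcongr
    · rw [abs_mul, abs_of_nonneg hl]; gcongr
  have h3 : |‖z‖ ^ 2 - ‖g‖ ^ 2 * (p * r)| ≤ |‖z‖ ^ 2 - (l * ‖g‖) ^ 2| + |p * r - l ^ 2| := by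
    have : ‖z‖ ^ 2 - ‖g‖ ^ 2 * (p * r) =
        (‖z‖ ^ 2 - (l * ‖g‖) ^ 2) - ‖g‖ ^ 2 * (p * r - l ^ 2) := by ring
    rw [this]
    refine (abs_sub _ _).trans (add_le_add le_rfl ?_)
    rw [abs_mul, abs_of_nonneg (by positivity)]
    have : ‖g‖ ^ 2 ≤ 1 := pow_le_one₀ (norm_nonneg g) hg
    nlinarith [abs_nonneg (p * r - l ^ 2)]
  have a1 := amgm ‖z - l * g‖
  have a2 := amgm |p - l|
  have a3 := amgm |r - l|
  rw [sq_abs] at a2 a3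
  have b1 : ‖z - l * g‖ ^ 2 ≤ 1 / e * ‖z - l * g‖ ^ 2 := by nlinarith [sq_nonneg ‖z - l * g‖]
  have b2 : (p - l) ^ 2 + (r - l) ^ 2 ≤ 1 / e * ((p - l) ^ 2 + (r - l) ^ 2) := by
    nlinarith [sq_nonneg (p - l), sq_nonneg (r - l)]
  have b3 : 2 / e * ‖z - l * g‖ ^ 2 = 2 * (1 / e * ‖z - l * g‖ ^ 2) := by ring
  rw [b3]
  linarith

/-- A lower bound for a truncated product that needs only second moments: when the truncation fails,
one of the squares already exceeds ρ²/4. -/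
theorem quarter_sub_le_ite (p r ρ : ℝ) (hρ : 0 < ρ) :
    ρ ^ 2 / 4 - (p - ρ) ^ 2 - (r - ρ) ^ 2 ≤
      if |p - ρ| ≤ ρ / 2 ∧ |r - ρ| ≤ ρ / 2 then p * r else 0 := by
  split_ifs with h
  · have h1 := abs_le.mp h.1
    have h2 := abs_le.mp h.2
    have : ρ / 2 * (ρ / 2) ≤ p * r := by
      apply mul_le_mul <;> linarith
    nlinarith [sq_nonneg (p - ρ), sq_nonneg (r - ρ)]
  · rw [not_and_or] at h
    rcases h with h | h <;> push Not at h
    · have : (ρ / 2) ^ 2 ≤ |p - ρ| ^ 2 := pow_le_pow_left₀ (by positivity) h.le 2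
      rw [sq_abs] at this
      nlinarith [sq_nonneg (r - ρ)]
    · have : (ρ / 2) ^ 2 ≤ |r - ρ| ^ 2 := pow_le_pow_left₀ (by positivity) h.le 2
      rw [sq_abs] at this
      nlinarith [sq_nonneg (p - ρ)]

section Averages

open Protocol

variable {d q n : ℕ} [NeZero d] {e : ℝ} {ψ φ : Fin d → ℂ}

/-- The case ψ = φ of the bound for block inner products. -/
theorem sum_sq_blockProb_sub_le (t : Fin (d / q + 1)) (hψ : ∑ x, ‖ψ x‖ ^ 2 = 1) :
    ∑ u : BasisSeed d, (blockProb (randomBlock d q u) ψ t - blockSize d q t / d) ^ 2 ≤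
      Fintype.card (BasisSeed d) * (2 * q / (d * (d - 1))) := by
  refine le_trans (le_of_eq ?_) (sum_norm_blockInner_sub_sq_le d q t ψ ψ hψ hψ)
  refine Finset.sum_congr rfl fun u _ => ?_
  have h : ∑ x, star (ψ x) * ψ x = 1 := by
    refine (Finset.sum_congr rfl fun x _ => Complex.conj_mul' (ψ x)).trans ?_
    exact_mod_cast hψ
  rw [blockInner_self, h, mul_one, ← Complex.ofReal_sub, Complex.norm_real, Real.norm_eq_abs,
    sq_abs]

/-- The mean of the error of a round is small compared to the probability of a collision. -/
theorem sum_abs_round_error_le (hq : 0 < q) (he : 0 < e) (he1 : e ≤ 1)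
    (hde : 2 * q / (d * (d - 1)) ≤ (e * (q / d : ℝ)) ^ 2) (hψ : ∑ x, ‖ψ x‖ ^ 2 = 1)
    (hφ : ∑ x, ‖φ x‖ ^ 2 = 1) (hg : ‖∑ x, star (ψ x) * φ x‖ ≤ 1) :
    ∑ u : BasisSeed d, |∑ a : Fin (n + 1) → Fin (d / q + 1), ∑ b : Fin (n + 1) → Fin (d / q + 1),
      ∑ s, roundWeight (randomBlock d q u) ψ φ a b s *
        (swapSign s * hit a b - ‖∑ x, star (ψ x) * φ x‖ ^ 2 * hit a b)| ≤
      Fintype.card (BasisSeed d) *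
        ((n + 1) ^ 2 * ((d / q + 1 : ℕ) * (6 * e * (q / d : ℝ) ^ 2))) := by
  set g := ∑ x, star (ψ x) * φ x
  set ρ : ℝ := q / d
  set M : ℝ := (Fintype.card (BasisSeed d) : ℝ)
  have hM : 0 ≤ M := Nat.cast_nonneg _
  have ht : ∀ t : Fin (d / q + 1), ∑ u : BasisSeed d,
      |‖blockInner (randomBlock d q u) ψ φ t t‖ ^ 2 - ‖g‖ ^ 2 *
        (blockProb (randomBlock d q u) ψ t * blockProb (randomBlock d q u) φ t)| ≤
      M * (6 * e * ρ ^ 2) := by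
    intro t
    have hl : 0 ≤ blockSize d q t / d := div_nonneg (blockSize_nonneg d q t) (Nat.cast_nonneg d)
    have hlρ : blockSize d q t / d ≤ ρ := by
      have := blockSize_le d q t
      simp only [ρ]; gcongr
    have m1 := (sum_norm_blockInner_sub_sq_le d q t ψ φ hψ hφ).trans
      (mul_le_mul_of_nonneg_left hde hM)
    have m2 := (sum_sq_blockProb_sub_le t hψ).trans (mul_le_mul_of_nonneg_left hde hM)
    have m3 := (sum_sq_blockProb_sub_le t hφ).trans (mul_le_mul_of_nonneg_left hde hM)
    calc _ ≤ _ := Finset.sum_le_sum fun u _ => abs_norm_sq_sub_mul_le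
          (blockInner (randomBlock d q u) ψ φ t t) g (blockProb (randomBlock d q u) ψ t)
          (blockProb (randomBlock d q u) φ t) (blockSize d q t / d) ρ e hl hlρ he he1 hg
      _ ≤ 2 / e * (M * (e * ρ) ^ 2) + 1 / e * (M * (e * ρ) ^ 2 + M * (e * ρ) ^ 2) +
          M * (2 * e * ρ ^ 2) := by
          simp only [Finset.sum_add_distrib, ← Finset.mul_sum, Finset.sum_const, Finset.card_univ,
            nsmul_eq_mul]
          exact add_le_add (add_le_add (mul_le_mul_of_nonneg_left m1 (by positivity))
            (mul_le_mul_of_nonneg_left (add_le_add m2 m3) (by positivity)))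
            (le_of_eq (mul_left_comm _ _ _))
      -- Each second moment is at most (eρ)², so the three terms contribute 2eρ² each.
      _ = M * (6 * e * ρ ^ 2) := by field_simp; ring
  calc _ ≤ ∑ u : BasisSeed d, (n + 1 : ℝ) ^ 2 * ∑ t,
        |‖blockInner (randomBlock d q u) ψ φ t t‖ ^ 2 - ‖g‖ ^ 2 *
        (blockProb (randomBlock d q u) ψ t * blockProb (randomBlock d q u) φ t)| :=
        Finset.sum_le_sum fun u _ => abs_sum_round_error_le _ (sum_randomBlock d q hq u) ψ φ hψ hφ _
    _ ≤ (n + 1 : ℝ) ^ 2 * ∑ _t : Fin (d / q + 1), M * (6 * e * ρ ^ 2) := by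
        rw [← Finset.mul_sum, Finset.sum_comm]
        gcongr with t
        exact ht t
    _ = _ := by
        rw [Finset.sum_const, Finset.card_univ, Fintype.card_fin, nsmul_eq_mul]; ring

/-- The collision bound is applied to the full blocks where both probabilities are within ρ/2 of ρ =
q/d, hence at most τ = 2ρ. With e ≤ 1/4 the two variances cost at most ρ²/8 of the ρ²/4 in
`quarter_sub_le_ite`. -/
theorem sum_hit_ge (hq : 0 < q) (he : 0 < e) (he1 : e ≤ 1 / 4)
    (hde : 2 * q / (d * (d - 1)) ≤ (e * (q / d : ℝ)) ^ 2) (hψ : ∑ x, ‖ψ x‖ ^ 2 = 1)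
    (hφ : ∑ x, ‖φ x‖ ^ 2 = 1) (hn : (n : ℝ) ^ 2 * (2 * (q / d)) ≤ 1) :
    Fintype.card (BasisSeed d) * ((n + 1) ^ 2 / 4 * ((d / q : ℕ) * ((q / d : ℝ) ^ 2 / 8))) ≤
    ∑ u : BasisSeed d, ∑ a : Fin (n + 1) → Fin (d / q + 1), ∑ b : Fin (n + 1) → Fin (d / q + 1),
      ∑ s, roundWeight (randomBlock d q u) ψ φ a b s * hit a b := by
  classical
  set ρ : ℝ := q / d
  set M : ℝ := (Fintype.card (BasisSeed d) : ℝ)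
  have hM : 0 ≤ M := Nat.cast_nonneg _
  have hd0 : (0 : ℝ) < d := Nat.cast_pos.mpr (NeZero.pos d)
  have hρ : 0 < ρ := div_pos (Nat.cast_pos.mpr hq) hd0
  let full : Finset (Fin (d / q + 1)) := Finset.univ.filter fun t => t.val < d / q
  have hfull : full.card = d / q := by
    have : full = Finset.univ.map Fin.castSuccEmb := by
      ext t
      simp only [full, Finset.mem_filter, Finset.mem_univ, true_and, Finset.mem_map,
        Fin.castSuccEmb_apply]
      constructor
      · intro h; exact ⟨⟨t.val, h⟩, rfl⟩
      · rintro ⟨s, rfl⟩; exact s.isLt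
    rw [this, Finset.card_map, Finset.card_univ, Fintype.card_fin]
  let good : BasisSeed d → Finset (Fin (d / q + 1)) := fun u => full.filter fun t =>
    |blockProb (randomBlock d q u) ψ t - ρ| ≤ ρ / 2 ∧
      |blockProb (randomBlock d q u) φ t - ρ| ≤ ρ / 2
  have ht : ∀ t ∈ full, M * (ρ ^ 2 / 8) ≤ ∑ u : BasisSeed d,
      if |blockProb (randomBlock d q u) ψ t - ρ| ≤ ρ / 2 ∧
        |blockProb (randomBlock d q u) φ t - ρ| ≤ ρ / 2 then
        blockProb (randomBlock d q u) ψ t * blockProb (randomBlock d q u) φ t else 0 := by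
    intro t ht
    have hs := blockSize_eq d q t (by simpa [full] using ht)
    have m2 := (sum_sq_blockProb_sub_le t hψ).trans (mul_le_mul_of_nonneg_left hde hM)
    have m3 := (sum_sq_blockProb_sub_le t hφ).trans (mul_le_mul_of_nonneg_left hde hM)
    rw [hs] at m2 m3
    refine le_trans ?_ (Finset.sum_le_sum fun u _ => quarter_sub_le_ite _ _ ρ hρ)
    rw [Finset.sum_sub_distrib, Finset.sum_sub_distrib, Finset.sum_const, Finset.card_univ,
      nsmul_eq_mul]
    change _ ≤ M * _ - _ - _
    have : M * (e * ρ) ^ 2 ≤ M * (ρ ^ 2 / 16) := by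
      apply mul_le_mul_of_nonneg_left _ hM
      have : e ^ 2 ≤ 1 / 16 := by nlinarith
      nlinarith [sq_nonneg ρ]
    linarith
  calc _ = (n + 1 : ℝ) ^ 2 / 4 * ∑ _t ∈ full, M * (ρ ^ 2 / 8) := by
        rw [Finset.sum_const, hfull, nsmul_eq_mul]; ring
    _ ≤ (n + 1 : ℝ) ^ 2 / 4 * ∑ t ∈ full, ∑ u : BasisSeed d,
        if |blockProb (randomBlock d q u) ψ t - ρ| ≤ ρ / 2 ∧
          |blockProb (randomBlock d q u) φ t - ρ| ≤ ρ / 2 then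
          blockProb (randomBlock d q u) ψ t * blockProb (randomBlock d q u) φ t else 0 :=
        mul_le_mul_of_nonneg_left (Finset.sum_le_sum ht) (by positivity)
    _ = ∑ u : BasisSeed d, (n + 1 : ℝ) ^ 2 / 4 * ∑ t ∈ good u,
        blockProb (randomBlock d q u) ψ t * blockProb (randomBlock d q u) φ t := by
        rw [Finset.sum_comm, Finset.mul_sum]
        simp only [good, Finset.sum_filter]
    _ ≤ _ := by
        refine Finset.sum_le_sum fun u _ => ?_
        have hB := sum_randomBlock d q hq u
        refine (sum_collision_ge _ _ (sum_blockProb _ hB ψ hψ) (sum_blockProb _ hB φ hφ)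
          (blockProb_nonneg _ _) (blockProb_nonneg _ _) (good u) (2 * ρ) ?_ ?_ n hn).trans
          (le_of_eq ?_)
        · intro t h
          have := (abs_le.mp (Finset.mem_filter.mp h).2.1).2
          linarith
        · intro t h
          have := (abs_le.mp (Finset.mem_filter.mp h).2.2).2
          linarith
        · refine Finset.sum_congr rfl fun a _ => Finset.sum_congr rfl fun b _ => ?_
          rw [← Finset.sum_mul, sum_roundWeight, hit_eq]

end Averages

/-! ### Uniform shared randomness and the output law -/

namespace Protocol

section Estimator

variable {q d k : ℕ} {U : Type} [Fintype U] [Nonempty U]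

theorem bind_smul_count_apply {Ω : Type*} [Fintype Ω] [MeasurableSpace Ω]
    [DiscreteMeasurableSpace Ω] (c : ENNReal) (f : Ω → MeasureTheory.Measure ℝ) (s : Set ℝ)
    (hs : MeasurableSet s) :
    ((c • MeasureTheory.Measure.count : MeasureTheory.Measure Ω).bind f) s = c * ∑ ω, f ω s := by
  rw [MeasureTheory.Measure.bind_apply hs (Measurable.of_discrete).aemeasurable,
    MeasureTheory.lintegral_smul_measure, MeasureTheory.lintegral_count, tsum_fintype, smul_eq_mul]

/-- The protocol that draws `ω` uniformly from a finite type. -/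
noncomputable def uniformProtocol (U : Type) [Fintype U] [Nonempty U]
    (P : U → Protocol q (CopyBasis d k) (CopyBasis d k)) : SharedRandomnessProtocol q d k where
  Ω := U
  mΩ := ⊤
  μ := letI : MeasurableSpace U := ⊤
    (Fintype.card U : ENNReal)⁻¹ • MeasureTheory.Measure.count
  isProb := by
    let : MeasurableSpace U := ⊤
    refine ⟨?_⟩
    rw [MeasureTheory.Measure.smul_apply, MeasureTheory.Measure.count_apply_finite _ Set.finite_univ]
    simp [ENNReal.inv_mul_cancel]
  protocol := P
  measurable_law := fun _ _ _ _ => measurable_from_top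

theorem outputLaw_uniformProtocol (P : U → Protocol q (CopyBasis d k) (CopyBasis d k))
    (ψ φ : EuclideanSpace ℂ (Fin d)) (s : Set ℝ) (hs : MeasurableSet s) :
    (uniformProtocol U P).outputLaw ψ φ s =
      (Fintype.card U : ENNReal)⁻¹ * (∑ ω, (P ω).law (copiesInput k ψ φ)) s := by
  let : MeasurableSpace U := ⊤
  rw [MeasureTheory.Measure.finsetSum_apply]
  exact bind_smul_count_apply (Ω := U) _ (fun ω => (P ω).law (copiesInput k ψ φ)) s hs

theorem outputLaw_rounds {N n : ℕ} (B : U → Fin N → Matrix (Fin q) (Fin d) ℂ)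
    (hB : ∀ u, ∑ t, (B u t)ᴴ * B u t = 1) (ψ φ : EuclideanSpace ℂ (Fin d)) (m : ℕ) (s : Set ℝ)
    (hs : MeasurableSet s) [DecidablePred (· ∈ s)] :
    (uniformProtocol (Fin m → U) fun u => rounds n B hB m u 0 0).outputLaw ψ φ s =
      ENNReal.ofReal (∑ o : Fin m → RoundOutcome U n N,
        (∏ i, roundWeight (B (o i).1) ψ φ (o i).2.1 (o i).2.2.1 (o i).2.2.2 / Fintype.card U) *
        if (∑ i, swapSign (o i).2.2.2 * hit (o i).2.1 (o i).2.2.1) /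
          (∑ i, hit (o i).2.1 (o i).2.2.1) ∈ s then 1 else 0) := by
  have hc : (0 : ℝ) < (Fintype.card U : ℝ) ^ m := pow_pos (Nat.cast_pos.mpr Fintype.card_pos) m
  have hcard : (Fintype.card (Fin m → U) : ENNReal)⁻¹ =
      ENNReal.ofReal (((Fintype.card U : ℝ) ^ m)⁻¹) := by
    rw [ENNReal.ofReal_inv_of_pos hc, ENNReal.ofReal_pow (Nat.cast_nonneg _),
      ENNReal.ofReal_natCast, Fintype.card_fun, Fintype.card_fin, Nat.cast_pow]
  have hdiv : ∀ A C : ℝ, 0 < C →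
      ENNReal.ofReal (A / C) = ENNReal.ofReal C⁻¹ * ENNReal.ofReal A := by
    intro A C hC
    rw [div_eq_inv_mul, ENNReal.ofReal_mul (by positivity)]
  rw [outputLaw_uniformProtocol _ _ _ _ hs, sum_law_rounds, MeasureTheory.Measure.finsetSum_apply,
    hcard, ENNReal.ofReal_sum_of_nonneg, Finset.mul_sum]
  · refine Finset.sum_congr rfl fun o _ => ?_
    rw [MeasureTheory.Measure.smul_apply, MeasureTheory.Measure.dirac_apply' _ hs, smul_eq_mul,
      zero_add, zero_add, ENNReal.ofReal_mul, Finset.prod_div_distrib, Finset.prod_const,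
      Finset.card_univ, Fintype.card_fin, hdiv _ _ hc, mul_assoc]
    · congr 2
      simp only [Set.indicator_apply]
      split_ifs <;> simp
    · exact Finset.prod_nonneg fun i _ => div_nonneg (roundWeight_nonneg _ _ _ _ _ _)
        (Nat.cast_nonneg _)
  · intro o _
    refine mul_nonneg (Finset.prod_nonneg fun i _ => div_nonneg (roundWeight_nonneg _ _ _ _ _ _)
        (Nat.cast_nonneg _)) ?_
    split_ifs <;> norm_num

end Estimator

end Protocol

/-! ### Choice of parameters and conclusion -/

section Main

open Protocol

theorem exists_round_estimator {d q : ℕ} [NeZero d] (hq : 0 < q) (hqd : q ≤ d) {ε : ℝ}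
    (hε : 0 < ε) (hε1 : ε < 1)
    (hde : 2 * q / (d * (d - 1)) ≤ (ε / 24576 * (q / d : ℝ)) ^ 2) {n : ℕ}
    (hn : (n : ℝ) ^ 2 * (2 * (q / d)) ≤ 1) (hn' : 1 ≤ (n + 1 : ℝ) ^ 2 * (2 * (q / d)))
    {ψ φ : EuclideanSpace ℂ (Fin d)} (hψ : ‖ψ‖ = 1) (hφ : ‖φ‖ = 1) {δ : ℝ} (hδ : 0 < δ) {m : ℕ}
    (hm : 68 / (δ * (1 / 128) ^ 2) / ε ^ 2 ≤ m) :
    ENNReal.ofReal (1 - δ) ≤ (uniformProtocol (Fin m → BasisSeed d) fun u =>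
      rounds n (randomBlock d q) (sum_randomBlock d q hq) m u 0 0).outputLaw ψ φ
        {x : ℝ | |x - ‖inner ℂ ψ φ‖ ^ 2| ≤ ε} := by
  classical
  have hmeas : MeasurableSet {x : ℝ | |x - ‖inner ℂ ψ φ‖ ^ 2| ≤ ε} :=
    measurableSet_le (by fun_prop) (by fun_prop)
  rw [outputLaw_rounds _ _ _ _ _ _ hmeas]
  apply ENNReal.ofReal_le_ofReal
  set F : ℝ := ‖inner ℂ ψ φ‖ ^ 2
  set M : ℝ := (Fintype.card (BasisSeed d) : ℝ)
  have hM : 0 < M := Nat.cast_pos.mpr Fintype.card_pos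
  have hg : inner ℂ ψ φ = ∑ x, star (ψ x) * φ x := by
    rw [PiLp.inner_apply]
    exact Finset.sum_congr rfl fun x _ => by rw [RCLike.inner_apply']; rfl
  have hg1 : ‖inner ℂ ψ φ‖ ≤ 1 := by
    have := norm_inner_le_norm (𝕜 := ℂ) ψ φ
    rwa [hψ, hφ, one_mul] at this
  have hψ' : ∑ x, ‖ψ x‖ ^ 2 = 1 := by rw [← EuclideanSpace.norm_sq_eq, hψ, one_pow]
  have hφ' : ∑ x, ‖φ x‖ ^ 2 = 1 := by rw [← EuclideanSpace.norm_sq_eq, hφ, one_pow]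
  have hd0 : (0 : ℝ) < d := Nat.cast_pos.mpr (NeZero.pos d)
  have hq0 : (0 : ℝ) < q := Nat.cast_pos.mpr hq
  set ρ : ℝ := q / d with hρdef
  have hρ : 0 < ρ := div_pos hq0 hd0
  have hρ1 : ρ ≤ 1 := (div_le_one hd0).mpr (Nat.cast_le.mpr hqd)
  have hblocks : 1 ≤ ((d / q : ℕ) : ℝ) := by exact_mod_cast Nat.div_pos hqd hq
  have hinv : (d : ℝ) / q = 1 / ρ := by rw [hρdef, one_div_div]
  have hblocks_le : ((d / q : ℕ) : ℝ) * ρ ≤ 1 := by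
    have : ((d / q : ℕ) : ℝ) ≤ d / q := Nat.cast_div_le
    rwa [hinv, le_div_iff₀ hρ] at this
  have hblocks_ge : 1 / 2 ≤ ((d / q : ℕ) : ℝ) * ρ := by
    have h1 : (d : ℝ) / q < (d / q : ℕ) + 1 := by
      rw [div_lt_iff₀ hq0]
      have := Nat.lt_div_mul_add (a := d) hq
      have h2 : (d : ℝ) < (d / q : ℕ) * q + q := by exact_mod_cast this
      linarith
    rw [hinv, div_lt_iff₀ hρ] at h1
    nlinarith
  let w : RoundOutcome (BasisSeed d) n (d / q + 1) → ℝ := fun o =>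
    roundWeight (randomBlock d q o.1) ψ φ o.2.1 o.2.2.1 o.2.2.2 / M
  have hexp : ∀ f : RoundOutcome (BasisSeed d) n (d / q + 1) → ℝ, ∑ o, w o * f o =
      (∑ u, ∑ a, ∑ b, ∑ s, roundWeight (randomBlock d q u) ψ φ a b s * f (u, a, b, s)) / M := by
    intro f
    simp only [Fintype.sum_prod_type (α₁ := BasisSeed d),
      Fintype.sum_prod_type (α₁ := Fin (n + 1) → Fin (d / q + 1)), Finset.sum_div, w,
      div_mul_eq_mul_div]
  have hw : ∑ o, w o = 1 := by
    have h := hexp fun _ => 1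
    simp only [mul_one, sum_roundWeight, ← Finset.mul_sum] at h
    rw [h, div_eq_one_iff_eq hM.ne']
    calc _ = ∑ _u : BasisSeed d, (1 : ℝ) := by
          refine Finset.sum_congr rfl fun u _ => ?_
          have hB := sum_randomBlock d q hq u
          rw [sum_iid_weight _ (sum_blockProb _ hB φ hφ'), ← Finset.sum_mul,
            sum_iid_weight _ (sum_blockProb _ hB ψ hψ'), one_mul]
      _ = M := by simp [M]
  have hF1 : F ≤ 1 := pow_le_one₀ (norm_nonneg _) hg1
  refine sum_iid_ratio_close w hw (fun o => div_nonneg (roundWeight_nonneg _ _ _ _ _ _) hM.le)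
    (fun o => swapSign o.2.2.2 * hit o.2.1 o.2.2.1) (fun o => hit o.2.1 o.2.2.1) F (1 / 128) ε δ m
    (by positivity) hF1 ?_ ?_ (by norm_num) hε hε1 hδ ?_ ?_ hm
  · intro o
    rw [hit]; split_ifs <;> norm_num
  · intro o
    rw [hit, swapSign]; split_ifs <;> norm_num
  · rw [hexp, le_div_iff₀ hM]
    refine le_trans ?_ (sum_hit_ge hq (e := ε / 24576) (by positivity) (by linarith) hde hψ' hφ' hn)
    rw [mul_comm]
    refine mul_le_mul_of_nonneg_left ?_ hM.le
    -- With N = ⌊d/q⌋, the factors Nρ ≥ 1/2 and (n + 1)²ρ ≥ 1/2 in (n + 1)²/4 · Nρ²/8 give the hit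
    -- probability 1/128.
    have h1 : 1 / 2 * (1 : ℝ) ≤ ((d / q : ℕ) * ρ) * ((n + 1 : ℝ) ^ 2 * (2 * ρ)) :=
      mul_le_mul hblocks_ge hn' (by norm_num) (by linarith)
    change _ ≤ (n + 1 : ℝ) ^ 2 / 4 * ((d / q : ℕ) * (ρ ^ 2 / 8))
    nlinarith
  · rw [hexp, abs_div, abs_of_pos hM, div_le_iff₀ hM]
    refine (Finset.abs_sum_le_sum_abs _ _).trans ?_
    have h := sum_abs_round_error_le (n := n) hq (e := ε / 24576) (by positivity) (by linarith) hde
      hψ' hφ' (by rw [← hg]; exact hg1)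
    rw [← hg] at h
    refine h.trans ?_
    rw [mul_comm]
    refine mul_le_mul_of_nonneg_right ?_ hM.le
    change (n + 1 : ℝ) ^ 2 * ((d / q + 1 : ℕ) * (6 * (ε / 24576) * ρ ^ 2)) ≤ _
    -- From (n + 1)² ≤ 2n² + 2, 2n²ρ ≤ 1 and ρ ≤ 1. The bias is then at most 3 · 2 · 6 · ε/24576,
    -- below the permitted ε/512 = ε · (1/128)/4, since 24576 = 48 · 512.
    have h1 : (n + 1 : ℝ) ^ 2 * ρ ≤ 3 := by nlinarith [sq_nonneg ((n : ℝ) - 1)]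
    have h2 : ((d / q + 1 : ℕ) : ℝ) * ρ ≤ 2 := by push_cast; linarith
    have h3 : ((n + 1 : ℝ) ^ 2 * ρ) * (((d / q + 1 : ℕ) : ℝ) * ρ) ≤ 3 * 2 :=
      mul_le_mul h1 h2 (by positivity) (by norm_num)
    nlinarith

theorem mainTheorem4 (δ : ℝ) (hδ : 0 < δ) (hδ1 : δ < 1) :
    ∃ C₀ C₁ c₂ C₂ : ℝ, 0 < C₀ ∧ 0 < C₁ ∧ 0 < c₂ ∧ 0 < C₂ ∧
      ∀ (d q : ℕ) (ε : ℝ), 1 ≤ q → q ≤ d → 0 < ε → ε < 1 →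
        C₀ * Real.log (d : ℝ) / ε ^ 2 ≤ (q : ℝ) →
        ∃ (k m : ℕ) (P : SharedRandomnessProtocol q d k),
          (k : ℝ) ≤ C₁ * Real.sqrt ((d : ℝ) / (q : ℝ)) / ε ^ 2 ∧
          c₂ / ε ^ 2 ≤ (m : ℝ) ∧ (m : ℝ) ≤ C₂ / ε ^ 2 ∧
          P.UsesMessages m ∧
          ∀ ψ φ : EuclideanSpace ℂ (Fin d), ‖ψ‖ = 1 → ‖φ‖ = 1 →
            ENNReal.ofReal (1 - δ) ≤
              P.outputLaw ψ φ {x : ℝ | |x - ‖inner ℂ ψ φ‖ ^ 2| ≤ ε} := by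
  set K : ℝ := 68 / (δ * (1 / 128) ^ 2) with hKdef
  have hK1 : 1 ≤ K := by
    rw [hKdef, le_div_iff₀ (by positivity)]
    nlinarith
  have hK : 0 < K := by linarith
  refine ⟨8 * 24576 ^ 2, 4 * K, K, 2 * K, by norm_num, by positivity, hK, by positivity, ?_⟩
  intro d q ε hq hqd hε hε1 hlog
  have : NeZero d := ⟨by omega⟩
  have hd0 : (0 : ℝ) < d := Nat.cast_pos.mpr (NeZero.pos d)
  have hq0 : (0 : ℝ) < q := Nat.cast_pos.mpr hq
  have hε2 : 0 < ε ^ 2 := by positivity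
  -- The logarithm enters only through log d ≥ 1/2 for d ≥ 2, which leaves q ε² ≥ 4 · 24576². For d
  -- = 1 the logarithm vanishes, but so does the left-hand side, through division by zero.
  have hde : 2 * q / (d * (d - 1)) ≤ (ε / 24576 * (q / d : ℝ)) ^ 2 := by
    rcases (show d = 1 ∨ 2 ≤ d by omega) with rfl | hd2
    · have : (2 * q / ((1 : ℕ) * ((1 : ℕ) - 1)) : ℝ) = 0 := by norm_num
      rw [this]; positivity
    · have hd2' : (2 : ℝ) ≤ d := by exact_mod_cast hd2
      have hlog2 : 1 / 2 ≤ Real.log d :=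
        le_trans (by linarith [Real.log_two_gt_d9]) (Real.log_le_log two_pos hd2')
      rw [div_le_iff₀ hε2] at hlog
      have h1 : 4 * 24576 ^ 2 ≤ q * ε ^ 2 := by linarith
      have h2 : (ε / 24576 * (q / d : ℝ)) ^ 2 = q * (q * ε ^ 2) / (24576 ^ 2 * d ^ 2) := by
        field_simp
      rw [h2, div_le_div_iff₀ (by nlinarith) (by positivity)]
      calc (2 * q * (24576 ^ 2 * d ^ 2) : ℝ) ≤ q * (4 * 24576 ^ 2) * (d * (d - 1)) := by
            have : (d : ℝ) ^ 2 ≤ 2 * (d * (d - 1)) := by nlinarith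
            nlinarith
        _ ≤ _ := by
            have : (0 : ℝ) ≤ d * (d - 1) := by nlinarith
            gcongr
  set r : ℝ := Real.sqrt (d / q)
  have hr2 : r ^ 2 = d / q := Real.sq_sqrt (by positivity)
  have hr1 : 1 ≤ r := Real.one_le_sqrt.mpr ((one_le_div hq0).mpr (Nat.cast_le.mpr hqd))
  have hrρ : r ^ 2 * (q / d : ℝ) = 1 := by rw [hr2]; field_simp
  -- s = √(d/(2q)) solves s² · 2q/d = 1, so its floor n satisfies both n² · 2q/d ≤ 1 and (n + 1)² ·
  -- 2q/d ≥ 1.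
  set s : ℝ := Real.sqrt (1 / 2) * r
  have hs0 : 0 ≤ s := by positivity
  have hs2 : s ^ 2 * (2 * (q / d : ℝ)) = 1 := by
    have : Real.sqrt (1 / 2) ^ 2 = 1 / 2 := Real.sq_sqrt (by norm_num)
    rw [mul_pow, this]; linarith
  have hsr : s ≤ r := by
    have : Real.sqrt (1 / 2) ≤ 1 := Real.sqrt_le_one.mpr (by norm_num)
    nlinarith
  have hn1 : (⌊s⌋₊ : ℝ) ≤ s := Nat.floor_le hs0
  have hn2 : s ≤ (⌊s⌋₊ : ℝ) + 1 := (Nat.lt_floor_add_one s).le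
  have hm1 : K / ε ^ 2 ≤ (⌈K / ε ^ 2⌉₊ : ℝ) := Nat.le_ceil _
  have hKε : 1 ≤ K / ε ^ 2 := by
    rw [le_div_iff₀ hε2]
    have : ε ^ 2 ≤ 1 := pow_le_one₀ hε.le hε1.le
    linarith
  have hm2 : (⌈K / ε ^ 2⌉₊ : ℝ) ≤ 2 * K / ε ^ 2 := by
    have := (Nat.ceil_lt_add_one (by positivity : 0 ≤ K / ε ^ 2)).le
    rw [mul_div_assoc]; linarith
  refine ⟨(⌊s⌋₊ + 1) * ⌈K / ε ^ 2⌉₊, ⌈K / ε ^ 2⌉₊,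
    uniformProtocol (Fin ⌈K / ε ^ 2⌉₊ → BasisSeed d) fun u =>
      rounds ⌊s⌋₊ (randomBlock d q) (sum_randomBlock d q hq) _ u 0 0, ?_, hm1, hm2,
    fun u => usesMessages_rounds _ _ _ _ _ _, fun ψ φ hψ hφ =>
      exists_round_estimator hq hqd hε hε1 hde ?_ ?_ hψ hφ hδ hm1⟩
  -- Here s + 1 ≤ 2r since s ≤ r and r ≥ 1, and rounding up at most doubles K/ε² ≥ 1; hence the
  -- constant 4K.
  · push_cast
    calc ((⌊s⌋₊ : ℝ) + 1) * ⌈K / ε ^ 2⌉₊ ≤ (2 * r) * (2 * K / ε ^ 2) := by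
          gcongr
          linarith
      _ = _ := by ring
  · rw [← hs2]; gcongr
  · exact hs2.symm.le.trans (by gcongr)

end Main
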